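/- Let $G$ be a finite group, written multiplicatively. A sequence over $G$ is a finite unordered list $S = g_1 \cdot \ldots \cdot g_k$ of elements of $G$, repetitions allowed (an element of the free abelian monoid with basis $G$); $|S| = k$ is its length, and a subsequence of $S$ is a sequence in which each element of $G$ occurs at most as often as in $S$. A sequence is a product-one sequence if its terms can be ordered so that their product is $1$, and it is product-one free if none of its non-empty subsequences is a product-one sequence. The small Davenport constant $\mathsf{d}(G)$ is the maximum length of a product-one free sequence over $G$. The Gao constant $\mathsf{E}(G)$ is the smallest integer $\ell > 0$ such that every sequence $S$ over $G$ with $|S| \ge \ell$ has a product-one subsequence of length $|G|$. Let $D_{2n}$ denote the dihedral group of order $2n$ and $C_2$ the cyclic group of order $2$. Theorem. Let $n \ge 4$ be an even integer. Then $$\mathsf{E}(D_{2n} \times C_2) = 5n+1 \quad\text{and}\quad \mathsf{d}(D_{2n} \times C_2) = n+1.$$ In particular, $\mathsf{E}(D_{2n} \times C_2) = \mathsf{d}(D_{2n} \times C_2) + |D_{2n} \times C_2|$. -/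

import Mathlib

namespace ZeroSum

/-- A sequence over a group `G` is an element of the free abelian monoid with basis `G`, that is,
a finite multiset of elements of `G`. Its length is `Multiset.card`, and `T ≤ S` says that `T` is
a subsequence of `S`. -/
abbrev GroupSeq (G : Type*) := Multiset G

variable {G : Type*} [Group G]

/-- The set of products of `S`: the products of all the terms of `S`, taken in any order. -/
def products (S : GroupSeq G) : Set G :=
  {g | ∃ l : List G, (l : Multiset G) = S ∧ l.prod = g}

/-- The set of subsequence products of `S`: the union of the sets of products of all the
subsequences of `S` of length at least one. -/
def subProducts (S : GroupSeq G) : Set G :=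
  {g | ∃ T : GroupSeq G, T ≤ S ∧ 1 ≤ Multiset.card T ∧ g ∈ products T}

/-- `S` is a product-one sequence: its terms can be ordered so that their product is `1`. -/
def IsProductOne (S : GroupSeq G) : Prop := (1 : G) ∈ products S

/-- `S` is product-one free: no non-empty subsequence of `S` is a product-one sequence. -/
def IsProductOneFree (S : GroupSeq G) : Prop := (1 : G) ∉ subProducts S

variable (G)

/-- The set of lengths of product-one free sequences over `G`. -/
def productOneFreeLengths : Set ℕ :=
  {k | ∃ S : GroupSeq G, Multiset.card S = k ∧ IsProductOneFree S}

/-- The set of `ℓ > 0` such that every sequence over `G` of length at least `ℓ` has a product-one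
subsequence of length `|G|`. -/
def gaoLengths : Set ℕ :=
  {l | 0 < l ∧ ∀ S : GroupSeq G, l ≤ Multiset.card S →
    ∃ T : GroupSeq G, T ≤ S ∧ Multiset.card T = Nat.card G ∧ IsProductOne T}

/-- The small Davenport constant: the maximum length of a product-one free sequence over `G`. -/
noncomputable def smallDavenport : ℕ := sSup (productOneFreeLengths G)

/-- The Gao constant: the smallest `ℓ > 0` such that every sequence over `G` of length at least
`ℓ` has a product-one subsequence of length `|G|`. -/
noncomputable def gaoConstant : ℕ := sInf (gaoLengths G)

end ZeroSum

/-- The group `D_{2n} × C_2`, where `D_{2n}` is the dihedral group of order `2n`. -/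
abbrev DihedralTimesC2 (n : ℕ) := DihedralGroup n × Multiplicative (ZMod 2)

namespace ZeroSum

open scoped Pointwise

/-! Write `n = 2m`, so that the group has order `8m`. A reflection, the generator of `C_2` and `n -
1` copies of a generating rotation form a product-one free sequence of length `n + 1`. Padding a
product-one free `S` with `|G| - 1` ones shows `|S| + |G| ≤ E`. Hence this example bounds both
constants from below, and `E ≤ 5n + 1 = 10m + 1` also gives `d ≤ n + 1`. Only that upper bound is
hard (`exists_balanced`).

A reflection inverts rotations, so in a product the exponents carry signs: half of the reflections
get a minus and, if there is a reflection at all, the rotations may get any signs. As `n` is even,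
every term has a class in the quotient `C_2^3`. If the classes of a sequence sum to zero, its
exponents sum to some `2c`, and it remains to choose the minus terms with sum `c` modulo `m`.

Pair off terms of equal class among `10m + 1` terms. If at most three are left over, the
Erdős–Ginzburg–Ziv theorem applied to the pairs suffices. Otherwise five or seven are left over, and
omitting one or three of them makes the class sum zero. Now grow a set `F`, each new sum modulo `m`
costing at most two terms. Either fewer than `2m` terms reach every residue, and deleting pairs
outside `F` adjusts the length to `8m`; or growth stops at a set of sums whose stabilizer has index
`d > 1`. Then all other terms are congruent modulo `d`, and induction applies to `m / d`. Sequences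
with at most one reflection fall under Gao's theorem for `C_{2m} × C_2`. -/

/-! ### Zero-sum subsequences in finite abelian groups -/

/-- A submultiset of an image is the image of a submultiset. -/
theorem exists_le_map_eq {α β : Type*} {f : α → β} {S : Multiset α} {T : Multiset β}
    (h : T ≤ S.map f) : ∃ U ≤ S, U.map f = T := by
  classical
  induction S using Multiset.induction generalizing T with
  | empty => exact ⟨0, le_rfl, by simpa [eq_comm] using h⟩
  | cons a S ih =>
    rw [Multiset.map_cons] at h
    by_cases ha : f a ∈ T
    · obtain ⟨T', rfl⟩ := Multiset.exists_cons_of_mem ha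
      obtain ⟨U, hU, rfl⟩ := ih ((Multiset.cons_le_cons_iff _).1 h)
      exact ⟨a ::ₘ U, (Multiset.cons_le_cons_iff _).2 hU, by simp⟩
    · obtain ⟨U, hU, rfl⟩ := ih ((Multiset.le_cons_of_notMem ha).1 h)
      exact ⟨U, hU.trans (Multiset.le_cons_self _ _), rfl⟩

/-- **Scherk's theorem**: if `0` has a unique representation in `A + B`, then
`|A| + |B| - 1 ≤ |A + B|`. -/
theorem card_add_card_le_card_add_of_unique_zero {α : Type*} [AddCommGroup α] [DecidableEq α]
    (A B : Finset α) (hA : 0 ∈ A) (hB : 0 ∈ B) (h : ∀ a ∈ A, ∀ b ∈ B, a + b = 0 → b = 0) :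
    A.card + B.card ≤ (A + B).card + 1 := by
  induction hn : B.card using Nat.strong_induction_on generalizing A B with
  | _ n ih =>
  subst hn
  by_cases hB1 : ∀ b ∈ B, b = 0
  · have : B = {0} := Finset.eq_singleton_iff_unique_mem.2 ⟨hB, hB1⟩
    subst this
    simp
  push Not at hB1
  obtain ⟨b, hb, hb0⟩ := hB1
  -- Otherwise translation by `b ≠ 0` permutes `A`, and `0 ∈ A` gets a second representation as `a +
  -- b`.
  obtain ⟨a, ha, c, hc, hac⟩ : ∃ a ∈ A, ∃ c ∈ B, a + c ∉ A := by
    by_contra! hcon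
    have hsub : A.image (· + b) ⊆ A := by
      intro x hx
      obtain ⟨a, ha, rfl⟩ := Finset.mem_image.1 hx
      exact hcon a ha b hb
    have heq : A.image (· + b) = A := Finset.eq_of_subset_of_card_le hsub
      (Finset.card_image_of_injective _ (add_left_injective b)).ge
    rw [← heq] at hA
    obtain ⟨a, ha, hab⟩ := Finset.mem_image.1 hA
    exact hb0 (h a ha b hb hab)
  -- Dyson's transform: it preserves `|A| + |B|`, shrinks `B`, and does not enlarge the sumset.
  set A' := A ∪ B.image (a + ·) with hA'
  set B' := B.filter (fun x => a + x ∈ A) with hB'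
  have hB'lt : B'.card < B.card :=
    Finset.card_lt_card (Finset.filter_ssubset.2 ⟨c, hc, hac⟩)
  have hcard : A'.card + B'.card = A.card + B.card := by
    have h1 := Finset.card_union_add_card_inter A (B.image (a + ·))
    have h2 : A ∩ B.image (a + ·) = B'.image (a + ·) := by
      ext x
      simp only [hB', Finset.mem_inter, Finset.mem_image, Finset.mem_filter]
      constructor
      · rintro ⟨hx, y, hy, rfl⟩
        exact ⟨y, ⟨hy, hx⟩, rfl⟩
      · rintro ⟨y, ⟨hy, hx⟩, rfl⟩
        exact ⟨hx, y, hy, rfl⟩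
    rw [h2, Finset.card_image_of_injective _ (add_right_injective a),
      Finset.card_image_of_injective _ (add_right_injective a)] at h1
    exact h1
  have hsub : A' + B' ⊆ A + B := by
    intro x hx
    obtain ⟨y, hy, z, hz, rfl⟩ := Finset.mem_add.1 hx
    rw [hB', Finset.mem_filter] at hz
    rcases Finset.mem_union.1 hy with hy | hy
    · exact Finset.add_mem_add hy hz.1
    · obtain ⟨w, hw, rfl⟩ := Finset.mem_image.1 hy
      have : a + w + z = (a + z) + w := by abel
      rw [this]
      exact Finset.add_mem_add hz.2 hw
  have := ih B'.card hB'lt A' B' (Finset.mem_union_left _ hA)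
    (Finset.mem_filter.2 ⟨hB, by simpa using ha⟩) ?_ rfl
  · have := Finset.card_le_card hsub
    omega
  · intro x hx z hz hxz
    rw [hB', Finset.mem_filter] at hz
    rcases Finset.mem_union.1 hx with hx | hx
    · exact h x hx z hz.1 hxz
    · obtain ⟨w, hw, rfl⟩ := Finset.mem_image.1 hx
      have hw0 : w = 0 := h (a + z) hz.2 w hw (by rw [← hxz]; abel)
      subst hw0
      exact h a ha z hz.1 (by simpa using hxz)

/-- If a sequence without zeros and with multiplicities at most `h` has no short zero-sum
subsequence, then its short subsequences have many sums. -/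
theorem exists_many_short_sums {α : Type*} [AddCommGroup α] [DecidableEq α] (h : ℕ)
    (T : Multiset α) (h0 : (0 : α) ∉ T) (hcount : ∀ a, T.count a ≤ h)
    (hfree : ∀ V ≤ T, Multiset.card V ≤ h → V.sum = 0 → V = 0) :
    ∃ X : Finset α, 0 ∈ X ∧ Multiset.card T + 1 ≤ X.card ∧
      ∀ x ∈ X, ∃ V ≤ T, Multiset.card V ≤ h ∧ V.sum = x := by
  induction h generalizing T with
  | zero =>
    have : T = 0 := Multiset.eq_zero_of_forall_notMem fun a ha => by
      have := Multiset.one_le_count_iff_mem.2 ha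
      have := hcount a
      omega
    subst this
    exact ⟨{0}, by simp, by simp, fun x hx => ⟨0, by simp, by simp, by simp_all⟩⟩
  | succ h ih =>
    -- Peeling off one copy of each distinct term lowers all multiplicities; the support with `0` is
    -- then added back as a summand by Scherk's theorem, and each short sum grows by at most one
    -- term.
    have hle : T.dedup ≤ T := Multiset.dedup_le T
    obtain ⟨X, hX0, hXc, hX⟩ := ih (T - T.dedup)
      (fun hm => h0 (Multiset.mem_of_le (Multiset.sub_le_self _ _) hm))
      (fun a => by
        rw [Multiset.count_sub, Multiset.count_dedup]
        have := hcount a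
        split_ifs with ha
        · omega
        · rw [Multiset.count_eq_zero_of_notMem ha]; omega)
      (fun V hV hVc hVs => hfree V (hV.trans (Multiset.sub_le_self _ _)) (by omega) hVs)
    have hadd : ∀ V ≤ T - T.dedup, ∀ b ∈ T, b ::ₘ V ≤ T := by
      intro V hV b hb
      have h1 : {b} ≤ T.dedup := Multiset.singleton_le.2 (Multiset.mem_dedup.2 hb)
      have := add_le_add h1 hV
      rwa [Multiset.singleton_add, add_comm, Multiset.sub_add_cancel hle] at this
    have hB0 : (0 : α) ∉ T.toFinset := by simpa using h0
    refine ⟨X + insert 0 T.toFinset, ?_, ?_, ?_⟩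
    · exact Finset.mem_add.2 ⟨0, hX0, 0, Finset.mem_insert_self _ _, by simp⟩
    · have := card_add_card_le_card_add_of_unique_zero X (insert 0 T.toFinset) hX0
        (Finset.mem_insert_self _ _) ?_
      · rw [Finset.card_insert_of_notMem hB0] at this
        have h1 : Multiset.card (T - T.dedup) + T.toFinset.card = Multiset.card T := by
          rw [Multiset.card_toFinset, ← Multiset.card_add, Multiset.sub_add_cancel hle]
        omega
      · intro x hx b hb hxb
        rcases Finset.mem_insert.1 hb with rfl | hb
        · rfl
        · obtain ⟨V, hV, hVc, rfl⟩ := hX x hx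
          have := hfree (b ::ₘ V) (hadd V hV b (by simpa using hb)) (by simp; omega)
            (by simpa [add_comm] using hxb)
          simp at this
    · intro x hx
      obtain ⟨y, hy, b, hb, rfl⟩ := Finset.mem_add.1 hx
      obtain ⟨V, hV, hVc, rfl⟩ := hX y hy
      rcases Finset.mem_insert.1 hb with rfl | hb
      · exact ⟨V, hV.trans (Multiset.sub_le_self _ _), by omega, by simp⟩
      · exact ⟨b ::ₘ V, hadd V hV b (by simpa using hb), by simp; omega, by simp [add_comm]⟩

/-- Without such a subsequence there would be more than `|α|` distinct short sums. -/
theorem exists_short_zero_sum {α : Type*} [AddCommGroup α] [Fintype α] [DecidableEq α] (h : ℕ)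
    (T : Multiset α) (h0 : (0 : α) ∉ T) (hcount : ∀ a, T.count a ≤ h)
    (hcard : Fintype.card α ≤ Multiset.card T) :
    ∃ V ≤ T, V ≠ 0 ∧ Multiset.card V ≤ h ∧ V.sum = 0 := by
  by_contra! hcon
  obtain ⟨X, -, hX, -⟩ := exists_many_short_sums h T h0 hcount
    (fun V hV hVc hVs => by_contra fun hne => hcon V hV hne hVc hVs)
  have := Finset.card_le_univ X
  omega

/-- The Davenport constant of a finite abelian group is at most its order. -/
theorem exists_zero_sum_of_card_le {α β : Type*} [AddCommGroup α] [Fintype α] (f : β → α)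
    (T : Multiset β) (hcard : Fintype.card α ≤ Multiset.card T) :
    ∃ V ≤ T, V ≠ 0 ∧ (V.map f).sum = 0 := by
  classical
  suffices ∃ V ≤ T.map f, V ≠ 0 ∧ V.sum = 0 by
    obtain ⟨V, hV, hV0, hVs⟩ := this
    obtain ⟨U, hU, rfl⟩ := exists_le_map_eq hV
    exact ⟨U, hU, by rintro rfl; simp at hV0, hVs⟩
  by_cases h0 : (0 : α) ∈ T.map f
  · exact ⟨{0}, Multiset.singleton_le.2 h0, by simp, by simp⟩
  · obtain ⟨V, hV, hV0, -, hVs⟩ := exists_short_zero_sum (Multiset.card (T.map f)) (T.map f) h0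
      (fun a => Multiset.count_le_card _ _) (by simpa using hcard)
    exact ⟨V, hV, hV0, hVs⟩

/-- **Gao's theorem**: if every sequence of more than `D` terms has a non-empty zero-sum
subsequence, then every sequence of at least `L + D` terms has a zero-sum subsequence of length
`L`, for every multiple `L` of the exponent that is not less than the order. -/
theorem exists_zero_sum_of_card_eq {α : Type*} [AddCommGroup α] [Fintype α] (L D : ℕ)
    (hD : ∀ T : Multiset α, D < Multiset.card T → ∃ V ≤ T, V ≠ 0 ∧ V.sum = 0)
    (hL : Fintype.card α ≤ L) (hexp : ∀ a : α, L • a = 0) (S : Multiset α)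
    (hS : L + D ≤ Multiset.card S) :
    ∃ T ≤ S, Multiset.card T = L ∧ T.sum = 0 := by
  classical
  -- Here `h` will be the multiplicity of `0` in the whole sequence: a zero-sum `Z` within `h` of
  -- length `L` can be filled up with zeros. Blocks of length at most `h` are collected, so the
  -- length cannot jump over the window from `L - h` to `L`.
  have key : ∀ (h : ℕ) (T : Multiset α), (0 : α) ∉ T → (∀ a, T.count a ≤ h) →
      ∃ Z ≤ T, Z.sum = 0 ∧ Multiset.card Z ≤ L ∧
        (L ≤ Multiset.card Z + h ∨ Multiset.card T ≤ Multiset.card Z + D) := by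
    intro h T
    induction hn : Multiset.card T using Nat.strong_induction_on generalizing T with
    | _ n ih =>
    subst hn
    intro h0 hcount
    by_cases hc : Fintype.card α ≤ Multiset.card T
    · obtain ⟨V, hV, hV0, hVc, hVs⟩ := exists_short_zero_sum h T h0 hcount hc
      have hVpos := Multiset.card_pos.2 hV0
      have hcardV := Multiset.card_sub hV
      have hVT := Multiset.card_le_card hV
      obtain ⟨Z, hZ, hZs, hZL, hZ'⟩ := ih (Multiset.card (T - V)) (by omega) (T - V) rfl
        (fun hm => h0 (Multiset.mem_of_le (Multiset.sub_le_self _ _) hm))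
        (fun a => (Multiset.count_le_of_le a (Multiset.sub_le_self _ _)).trans (hcount a))
      by_cases hZh : L ≤ Multiset.card Z + h
      · exact ⟨Z, hZ.trans (Multiset.sub_le_self _ _), hZs, hZL, Or.inl hZh⟩
      · refine ⟨Z + V, ?_, by simp [hZs, hVs], by simp; omega, Or.inr ?_⟩
        · have := add_le_add_left hZ V
          rwa [Multiset.sub_add_cancel hV] at this
        · have := hZ'.resolve_left hZh
          simp
          omega
    -- Fewer than `|α| ≤ L` terms remain, so any zero-sum subsequence fits; a longest one misses at
    -- most `D` terms.
    · obtain ⟨Z, hZmem, hZmax⟩ := Finset.exists_max_image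
        (T.powerset.toFinset.filter (fun Z => Z.sum = 0)) Multiset.card ⟨0, by simp⟩
      simp only [Finset.mem_filter, Multiset.mem_toFinset, Multiset.mem_powerset] at hZmem hZmax
      have hZc := Multiset.card_le_card hZmem.1
      refine ⟨Z, hZmem.1, hZmem.2, by omega, Or.inr ?_⟩
      by_contra! hcon
      obtain ⟨V, hV, hV0, hVs⟩ := hD (T - Z) (by rw [Multiset.card_sub hZmem.1]; omega)
      have hmax := hZmax (Z + V) ⟨by
        have := add_le_add_right hV Z
        rwa [add_comm Z (T - Z), Multiset.sub_add_cancel hZmem.1] at this, by simp [hVs, hZmem.2]⟩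
      have := Multiset.card_pos.2 hV0
      rw [Multiset.card_add] at hmax
      omega
  -- Translating the most frequent term to `0` is harmless because `L • g = 0`.
  obtain ⟨g, -, hg⟩ := Finset.exists_max_image (Finset.univ : Finset α) (fun a => S.count a)
    ⟨0, Finset.mem_univ _⟩
  set S' := S.map (fun a => a - g) with hS'
  have hcount : ∀ a, S'.count a = S.count (a + g) := by
    intro a
    have := Multiset.count_map_eq_count' (fun a => a - g) S (sub_left_injective) (a + g)
    simpa using this
  have hsplit : S' = Multiset.replicate (S'.count 0) 0 + S'.filter (fun a => a ≠ 0) := by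
    conv_lhs => rw [← Multiset.filter_add_not (fun a => a = 0) S']
    congr 1
    convert Multiset.filter_eq' S' 0
  obtain ⟨Z, hZ, hZs, hZL, hZ'⟩ := key (S'.count 0) (S'.filter (fun a => a ≠ 0)) (by simp)
    (fun a => (Multiset.count_le_of_le a (Multiset.filter_le _ _)).trans (by
      rw [hcount, hcount, zero_add]
      exact hg _ (Finset.mem_univ _)))
  have hcardS := congrArg Multiset.card hsplit
  rw [Multiset.card_add, Multiset.card_replicate, hS', Multiset.card_map, ← hS'] at hcardS
  have hle : Multiset.replicate (L - Multiset.card Z) 0 + Z ≤ S' := by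
    rw [hsplit]
    refine add_le_add (Multiset.replicate_le_replicate _ |>.2 ?_) hZ
    omega
  obtain ⟨U, hU, hUeq⟩ := exists_le_map_eq hle
  have hUc := congrArg Multiset.card hUeq
  have hUs := congrArg Multiset.sum hUeq
  simp only [Multiset.card_map, Multiset.card_add, Multiset.card_replicate] at hUc
  have hUL : Multiset.card U = L := by omega
  refine ⟨U, hU, hUL, ?_⟩
  simpa [Multiset.sum_map_sub, hZs, hUL, hexp] using hUs

/-! ### Pairing, and distinct classes in elementary abelian 2-groups -/

/-- Terms with equal classes can be paired off until the classes are distinct. -/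
theorem exists_pairing {α β : Type*} (cl : α → β) (S : Multiset α) :
    ∃ (Q : Multiset (α × α)) (O : Multiset α), S = Q.map Prod.fst + Q.map Prod.snd + O ∧
      (∀ p ∈ Q, cl p.1 = cl p.2) ∧ (O.map cl).Nodup := by
  classical
  induction S using Multiset.induction with
  | empty => exact ⟨0, 0, by simp, by simp, by simp⟩
  | cons a S ih =>
    obtain ⟨Q, O, rfl, hQ, hO⟩ := ih
    by_cases ha : cl a ∈ O.map cl
    · obtain ⟨b, hb, hab⟩ := Multiset.mem_map.1 ha
      obtain ⟨O', rfl⟩ := Multiset.exists_cons_of_mem hb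
      rw [Multiset.map_cons] at hO
      refine ⟨(a, b) ::ₘ Q, O', ?_, ?_, (Multiset.nodup_cons.1 hO).2⟩
      · simp only [Multiset.map_cons]
        simp only [← Multiset.singleton_add]
        abel
      · intro p hp
        rcases Multiset.mem_cons.1 hp with rfl | hp
        · exact hab.symm
        · exact hQ p hp
    · refine ⟨Q, a ::ₘ O, by simp, hQ, ?_⟩
      rw [Multiset.map_cons]
      exact Multiset.nodup_cons.2 ⟨ha, hO⟩

/-- Repeated use of the Erdős–Ginzburg–Ziv theorem. -/
theorem exists_dvd_sum_of_card_le {β : Type*} (m q : ℕ) (hm : 0 < m) (f : β → ℤ) (S : Multiset β)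
    (hS : (q + 1) * m ≤ Multiset.card S + 1) :
    ∃ T ≤ S, Multiset.card T = q * m ∧ (m : ℤ) ∣ (T.map f).sum := by
  classical
  induction q generalizing S with
  | zero => exact ⟨0, by simp, by simp, by simp⟩
  | succ q ih =>
    obtain ⟨t, ht, htc, hts⟩ := Int.erdos_ginzburg_ziv_multiset (n := m) (S.map f) (by
      rw [Multiset.card_map]
      have : (q + 1 + 1) * m = q * m + 2 * m := by ring
      omega)
    obtain ⟨V, hV, rfl⟩ := exists_le_map_eq ht
    rw [Multiset.card_map] at htc
    obtain ⟨T, hT, hTc, hTs⟩ := ih (S - V) (by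
      rw [Multiset.card_sub hV, htc]
      have : (q + 1 + 1) * m = (q + 1) * m + m := by ring
      have := Multiset.card_le_card hV
      omega)
    refine ⟨T + V, ?_, ?_, ?_⟩
    · have := add_le_add_left hT V
      rwa [Multiset.sub_add_cancel hV] at this
    · simp [hTc, htc]; ring
    · rw [Multiset.map_add, Multiset.sum_add]
      exact dvd_add hTs hts

theorem exists_le_card_eq {α : Type*} {S : Multiset α} {k : ℕ} (h : k ≤ Multiset.card S) :
    ∃ T ≤ S, Multiset.card T = k := by
  induction S using Quotient.inductionOn with
  | _ l => exact ⟨l.take k, (List.take_sublist k l).subperm, by simpa using h⟩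

theorem sum_zmod_two_prod_eq_zero_or (O : Finset (ZMod 2 × ZMod 2)) (hO : O.card = 3) :
    ∃ U ⊆ O, U.Nonempty ∧ ∑ x ∈ U, x = 0 := by
  by_cases h0 : (0 : ZMod 2 × ZMod 2) ∈ O
  · exact ⟨{0}, by simpa using h0, by simp, by simp⟩
  · have hsub : O ⊆ Finset.univ.erase 0 := fun x hx =>
      Finset.mem_erase.2 ⟨fun h => h0 (h ▸ hx), Finset.mem_univ _⟩
    have hEq : O = Finset.univ.erase 0 := Finset.eq_of_subset_of_card_le hsub (by
      rw [hO]; decide)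
    exact ⟨O, subset_rfl, Finset.card_pos.1 (by omega), by rw [hEq]; decide⟩

set_option synthInstance.maxSize 2000 in
set_option synthInstance.maxHeartbeats 200000 in
theorem sum_compl_of_card_three : ∀ p q r : ZMod 2 × ZMod 2 × ZMod 2, p ≠ q → p ≠ r → q ≠ r →
    p + q + r ≠ p ∧ p + q + r ≠ q ∧ p + q + r ≠ r := by
  decide

theorem sum_univ_zmod_two : ∑ x : ZMod 2 × ZMod 2 × ZMod 2, x = 0 := by decide

/-- All classes together sum to zero, so the sum of `O` is that of the three missing classes, and
three distinct classes never sum to one of themselves. -/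
theorem sum_mem_of_card_five (O : Finset (ZMod 2 × ZMod 2 × ZMod 2)) (hO : O.card = 5) :
    ∑ x ∈ O, x ∈ O := by
  have hc : Oᶜ.card = 3 := by rw [Finset.card_compl, hO]; rfl
  have hsum := Finset.sum_add_sum_compl O (fun x => x)
  rw [sum_univ_zmod_two] at hsum
  obtain ⟨p, q, r, hpq, hpr, hqr, h⟩ := Finset.card_eq_three.1 hc
  rw [h, Finset.sum_insert (by simp [hpq, hpr]), Finset.sum_insert (by simp [hqr]),
    Finset.sum_singleton] at hsum
  have hneg : ∀ x y : ZMod 2 × ZMod 2 × ZMod 2, x + y = 0 → x = y := by decide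
  have := sum_compl_of_card_three p q r hpq hpr hqr
  rw [hneg _ _ hsum, ← Finset.notMem_compl, h]
  simp only [Finset.mem_insert, Finset.mem_singleton, not_or]
  rw [← add_assoc]
  exact this

set_option synthInstance.maxSize 2000 in
set_option synthInstance.maxHeartbeats 200000 in
set_option maxRecDepth 100000 in
theorem exists_triple_sum_eq : ∀ v c : ZMod 2 × ZMod 2 × ZMod 2, ∃ x y z,
    (x ≠ y ∧ x ≠ z ∧ y ≠ z) ∧ (x ≠ v ∧ y ≠ v ∧ z ≠ v) ∧ (x ≠ c ∧ y ≠ c ∧ z ≠ c) ∧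
    x + y + z = v ∧ x.2.2 = 0 := by
  decide

/-- The sum of seven classes is the missing one, `v`. Avoiding `c` allows a chosen term to be kept;
a rotation in the triple means that it uses at most two reflections. -/
theorem exists_triple_of_card_seven (O : Finset (ZMod 2 × ZMod 2 × ZMod 2)) (hO : O.card = 7)
    (c : ZMod 2 × ZMod 2 × ZMod 2) :
    ∃ U ⊆ O, U.card = 3 ∧ ∑ x ∈ U, x = ∑ x ∈ O, x ∧ c ∉ U ∧ ∃ x ∈ U, x.2.2 = 0 := by
  have hc : Oᶜ.card = 1 := by rw [Finset.card_compl, hO]; rfl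
  have hsum := Finset.sum_add_sum_compl O (fun x => x)
  obtain ⟨v, hv⟩ := Finset.card_eq_one.1 hc
  have hneg : ∀ x y : ZMod 2 × ZMod 2 × ZMod 2, x + y = 0 → x = y := by decide
  rw [sum_univ_zmod_two, hv, Finset.sum_singleton] at hsum
  obtain ⟨x, y, z, ⟨hxy, hxz, hyz⟩, ⟨hx, hy, hz⟩, ⟨hxc, hyc, hzc⟩, hs, hx0⟩ :=
    exists_triple_sum_eq v c
  have hmem : ∀ w, w ≠ v → w ∈ O := fun w hw => by
    rw [← Finset.notMem_compl, hv]; simpa using hw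
  refine ⟨{x, y, z}, ?_, Finset.card_eq_three.2 ⟨x, y, z, hxy, hxz, hyz, rfl⟩, ?_, ?_,
    x, by simp, hx0⟩
  · intro w hw
    simp only [Finset.mem_insert, Finset.mem_singleton] at hw
    rcases hw with rfl | rfl | rfl
    exacts [hmem _ hx, hmem _ hy, hmem _ hz]
  · rw [Finset.sum_insert (by simp [hxy, hxz]), Finset.sum_insert (by simp [hyz]),
      Finset.sum_singleton, hneg _ _ hsum, ← add_assoc, hs]
  · simp [hxc.symm, hyc.symm, hzc.symm]

/-- Lifting a subset of a family of distinct classes to the terms. -/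
theorem exists_le_of_subset_classes {α β : Type*} [DecidableEq β] {f : α → β} {S : Multiset α}
    (U : Finset β) (hU : U ⊆ (S.map f).toFinset) : ∃ R ≤ S, R.map f = U.val :=
  exists_le_map_eq ((Multiset.le_iff_subset U.nodup).2 fun x hx => by
    simpa using hU (by simpa using hx))

/-! ### The Davenport constant of `C_{2m} × C_2` -/

theorem even_sum_of_classes {m : ℕ} (B : Multiset (ZMod (2 * m) × ZMod 2))
    (hB : (B.map fun a => ((a.1.val : ZMod 2), a.2)).sum = 0) :
    2 ∣ (B.map fun a => a.1.val).sum ∧ (B.map Prod.snd).sum = 0 := by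
  have h : (B.map fun a => ((a.1.val : ZMod 2), a.2)).sum =
      ((((B.map fun a => a.1.val).sum : ℕ) : ZMod 2), (B.map Prod.snd).sum) := by
    clear hB
    induction B using Multiset.induction with
    | empty => simp; rfl
    | cons a B ih => simp [ih]
  rw [h, Prod.mk_eq_zero, ZMod.natCast_eq_zero_iff] at hB
  exact hB

/-- The Davenport constant of `C_{2m} × C_2` is at most `2m + 1`. -/
theorem exists_zero_sum_zmod_prod (m : ℕ) (hm : 0 < m) (S : Multiset (ZMod (2 * m) × ZMod 2))
    (hS : 2 * m < Multiset.card S) : ∃ V ≤ S, V ≠ 0 ∧ V.sum = 0 := by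
  classical
  have : NeZero m := ⟨hm.ne'⟩
  obtain ⟨S', hS', hc⟩ := exists_le_card_eq (Nat.succ_le_of_lt hS)
  let cl : ZMod (2 * m) × ZMod 2 → ZMod 2 × ZMod 2 := fun a => ((a.1.val : ZMod 2), a.2)
  obtain ⟨Q, O, hQO, hQ, hO⟩ := exists_pairing cl S'
  have hpair : ∀ x y : ZMod 2 × ZMod 2, x = y → x + y = 0 := by decide
  -- Of `2m + 1` terms, one or three stay unpaired. In the second case there are only `m - 1` pairs,
  -- and three distinct classes supply the missing block.
  obtain ⟨B, hBj, hBc, hB⟩ : ∃ B : Multiset (Multiset (ZMod (2 * m) × ZMod 2)), B.join ≤ S' ∧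
      m ≤ Multiset.card B ∧ ∀ b ∈ B, b ≠ 0 ∧ (b.map cl).sum = 0 := by
    have hcard := congrArg Multiset.card hQO
    simp only [Multiset.card_add, Multiset.card_map, hc] at hcard
    have hjoin : (Q.map fun p => ({p.1, p.2} : Multiset _)).join =
        Q.map Prod.fst + Q.map Prod.snd := by
      clear hQO hQ hcard
      induction Q using Multiset.induction with
      | empty => simp
      | cons p Q ih =>
        rw [Multiset.map_cons, Multiset.join_cons, ih]
        simp only [Multiset.map_cons, Multiset.insert_eq_cons]
        simp only [← Multiset.singleton_add]
        abel
    have hQB : ∀ b ∈ Q.map fun p => ({p.1, p.2} : Multiset _), b ≠ 0 ∧ (b.map cl).sum = 0 := by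
      intro b hb
      obtain ⟨p, hp, rfl⟩ := Multiset.mem_map.1 hb
      exact ⟨by simp, by simpa using hpair _ _ (hQ p hp)⟩
    have hOc : (O.map cl).toFinset.card = Multiset.card O := by
      rw [Multiset.toFinset_card_of_nodup hO, Multiset.card_map]
    have hO4 : Multiset.card O ≤ 4 := by
      rw [← hOc]; exact Finset.card_le_univ _
    by_cases hO3 : Multiset.card O = 3
    · obtain ⟨U, hUO, hU0, hUs⟩ := sum_zmod_two_prod_eq_zero_or _ (hOc.trans hO3)
      obtain ⟨R, hRO, hR⟩ := exists_le_of_subset_classes U hUO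
      refine ⟨R ::ₘ Q.map fun p => ({p.1, p.2} : Multiset _), ?_, ?_, ?_⟩
      · rw [Multiset.join_cons, hjoin, hQO, add_comm]
        gcongr
      · simp; omega
      · intro b hb
        rcases Multiset.mem_cons.1 hb with rfl | hb
        · refine ⟨?_, ?_⟩
          · rintro rfl
            simp [eq_comm] at hR
            simp [hR] at hU0
          · rw [hR, Finset.sum_val]; exact hUs
        · exact hQB b hb
    · refine ⟨Q.map fun p => ({p.1, p.2} : Multiset _), ?_, ?_, hQB⟩
      · rw [hjoin, hQO]
        exact Multiset.le_add_right _ _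
      · simp; omega
  -- The block sums are even with trivial `C_2` component; their halves live in `C_m`, where `m`
  -- blocks suffice.
  obtain ⟨V, hV, hV0, hVs⟩ := exists_zero_sum_of_card_le
    (fun b : Multiset (ZMod (2 * m) × ZMod 2) => (((b.map fun a => a.1.val).sum / 2 : ℕ) : ZMod m))
    B (by simpa using hBc)
  have hjoin : V.join ≤ B.join := by
    obtain ⟨W, rfl⟩ := Multiset.le_iff_exists_add.1 hV
    simp
  refine ⟨V.join, hjoin.trans (hBj.trans hS'), ?_, ?_⟩
  · obtain ⟨b, hb⟩ := Multiset.exists_mem_of_ne_zero hV0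
    obtain ⟨a, ha⟩ := Multiset.exists_mem_of_ne_zero (hB b (Multiset.mem_of_le hV hb)).1
    intro h
    have : a ∈ V.join := Multiset.mem_join.2 ⟨b, hb, ha⟩
    simp [h] at this
  · have hVB : ∀ b ∈ V, (b.map cl).sum = 0 := fun b hb => (hB b (Multiset.mem_of_le hV hb)).2
    have key : V.join.sum = (((2 * (V.map fun b => (b.map fun a => a.1.val).sum / 2).sum : ℕ) :
        ZMod (2 * m)), 0) := by
      clear hVs hV0 hV hjoin
      induction V using Multiset.induction with
      | empty => simp; rfl
      | cons b V ih =>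
        have h1 := even_sum_of_classes b (hVB b (by simp))
        have h2 : b.sum = ((((b.map fun a => a.1.val).sum : ℕ) : ZMod (2 * m)),
            (b.map Prod.snd).sum) := by
          clear hVB h1
          induction b using Multiset.induction with
          | empty => simp; rfl
          | cons a b ihb => simp [ihb, Prod.ext_iff]
        rw [Multiset.join_cons, Multiset.sum_add, ih fun c hc => hVB c (by simp [hc]), h2,
          Multiset.map_cons, Multiset.sum_cons, mul_add, Nat.mul_div_cancel' h1.1, h1.2]
        simp
    rw [key, Prod.mk_eq_zero, ZMod.natCast_eq_zero_iff]
    refine ⟨Nat.mul_dvd_mul_left 2 ?_, rfl⟩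
    rw [← ZMod.natCast_eq_zero_iff, ← hVs]
    simp [Multiset.map_map, Nat.cast_multiset_sum]

/-! ### The integer model and signed sums -/

/-- The integer model of `D_{2n} × C_2`: the triple `(i, j, ε)` stands for the rotation by `i` if
`ε = 0` and for a reflection if `ε = 1`, and `j` is the component in `C_2`. -/
abbrev Term := ℤ × ZMod 2 × ZMod 2

/-- The number of reflections. -/
def refl (S : Multiset Term) : ℕ := (S.map fun e => e.2.2.val).sum

/-- The sum of the integer components. -/
def isum (S : Multiset Term) : ℤ := (S.map Prod.fst).sum

/-- The sum of the `C_2` components. -/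
def jsum (S : Multiset Term) : ZMod 2 := (S.map fun e => e.2.1).sum

/-- The class of a term in the largest elementary abelian quotient. -/
def cl (e : Term) : ZMod 2 × ZMod 2 × ZMod 2 := ((e.1 : ZMod 2), e.2)

@[simp] theorem refl_zero : refl 0 = 0 := rfl
@[simp] theorem isum_zero : isum 0 = 0 := rfl
@[simp] theorem jsum_zero : jsum 0 = 0 := rfl
@[simp] theorem refl_cons (e : Term) (S : Multiset Term) :
    refl (e ::ₘ S) = e.2.2.val + refl S := by simp [refl]
@[simp] theorem isum_cons (e : Term) (S : Multiset Term) :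
    isum (e ::ₘ S) = e.1 + isum S := by simp [isum]
@[simp] theorem jsum_cons (e : Term) (S : Multiset Term) :
    jsum (e ::ₘ S) = e.2.1 + jsum S := by simp [jsum]
@[simp] theorem refl_add (S T : Multiset Term) : refl (S + T) = refl S + refl T := by simp [refl]
@[simp] theorem isum_add (S T : Multiset Term) : isum (S + T) = isum S + isum T := by simp [isum]
@[simp] theorem jsum_add (S T : Multiset Term) : jsum (S + T) = jsum S + jsum T := by simp [jsum]

theorem zmod_two_cases : ∀ x : ZMod 2, x = 0 ∨ x = 1 := by decide

theorem refl_mono {S T : Multiset Term} (h : S ≤ T) : refl S ≤ refl T := by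
  obtain ⟨U, rfl⟩ := Multiset.le_iff_exists_add.1 h
  simp

theorem refl_le_card (S : Multiset Term) : refl S ≤ Multiset.card S := by
  induction S using Multiset.induction with
  | empty => simp
  | cons e S ih =>
    have := ZMod.val_lt e.2.2
    simp
    omega

theorem sum_map_cl (S : Multiset Term) :
    (S.map cl).sum = ((isum S : ZMod 2), jsum S, (refl S : ZMod 2)) := by
  induction S using Multiset.induction with
  | empty => simp; rfl
  | cons e S ih => simp [ih, cl, Prod.ext_iff]

theorem refl_pos_of_mem {S : Multiset Term} {e : Term} (he : e ∈ S) (h : e.2.2 = 1) :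
    0 < refl S := by
  obtain ⟨S', rfl⟩ := Multiset.exists_cons_of_mem he
  simp only [refl_cons, h]
  have : (1 : ZMod 2).val = 1 := rfl
  omega

theorem exists_mem_of_refl_pos {S : Multiset Term} (h : 0 < refl S) : ∃ e ∈ S, e.2.2 = 1 := by
  by_contra! hcon
  have : refl S = 0 := Multiset.sum_eq_zero fun x hx => by
    obtain ⟨e, he, rfl⟩ := Multiset.mem_map.1 hx
    simp [(zmod_two_cases e.2.2).resolve_right (hcon e he)]
  omega

theorem exists_le_refl_eq (S : Multiset Term) (k : ℕ) (hk : k ≤ refl S) :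
    ∃ N ≤ S, refl N = k := by
  induction S using Multiset.induction generalizing k with
  | empty => exact ⟨0, le_rfl, by simp_all⟩
  | cons e S ih =>
    by_cases h : k ≤ refl S
    · obtain ⟨N, hN, hNk⟩ := ih k h
      exact ⟨N, hN.trans (Multiset.le_cons_self _ _), hNk⟩
    · refine ⟨e ::ₘ S, le_rfl, ?_⟩
      have := ZMod.val_lt e.2.2
      simp at hk ⊢
      omega

/-- The model of a product-one sequence: the terms of `P` get a plus sign, those of `N` a minus
sign, and minus signs are only available in the presence of reflections. -/
def Balanced (m : ℕ) (T : Multiset Term) : Prop :=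
  ∃ P N, T = P + N ∧ refl P = refl N ∧ (refl P = 0 → N = 0) ∧
    (2 * m : ℤ) ∣ isum P - isum N ∧ jsum T = 0

theorem Balanced.zero (m : ℕ) : Balanced m 0 := ⟨0, 0, by simp⟩

theorem Balanced.add {m : ℕ} {S T : Multiset Term} (hS : Balanced m S) (hT : Balanced m T) :
    Balanced m (S + T) := by
  obtain ⟨P, N, rfl, h1, h2, h3, h4⟩ := hS
  obtain ⟨P', N', rfl, h1', h2', h3', h4'⟩ := hT
  refine ⟨P + P', N + N', by abel, by simp [h1, h1'], ?_, ?_, ?_⟩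
  · intro h
    rw [refl_add] at h
    rw [h2 (by omega), h2' (by omega), add_zero]
  · rw [isum_add, isum_add, add_sub_add_comm]
    exact dvd_add h3 h3'
  · rw [jsum_add, h4, h4', add_zero]

/-- The sums modulo `m` of the sets of terms that may get a minus sign. -/
def reach (m : ℕ) (F : Multiset Term) : Set (ZMod m) :=
  {x | ∃ N ≤ F, 2 * refl N = refl F ∧ (isum N : ZMod m) = x}

/-- The class sum makes `isum T = 2c`. Choosing `N` with sum `c` modulo `m` gives `isum P - isum N =
2(c - isum N)`, divisible by `2m`. -/
theorem balanced_of_reach {m : ℕ} {T : Multiset Term} (hT : (T.map cl).sum = 0)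
    (hr : 0 < refl T) (h : reach m T = Set.univ) : Balanced m T := by
  rw [sum_map_cl, Prod.mk_eq_zero, Prod.mk_eq_zero, ZMod.intCast_zmod_eq_zero_iff_dvd] at hT
  obtain ⟨⟨c, hc⟩, hj, -⟩ := hT
  obtain ⟨N, hN, hNr, hNs⟩ : (c : ZMod m) ∈ reach m T := h ▸ Set.mem_univ _
  obtain ⟨P, rfl⟩ := Multiset.le_iff_exists_add.1 hN
  rw [refl_add] at hNr hr
  refine ⟨P, N, add_comm _ _, by omega, by omega, ?_, hj⟩
  have hd : (m : ℤ) ∣ c - isum N := (ZMod.intCast_eq_intCast_iff_dvd_sub _ _ _).1 hNs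
  rw [isum_add] at hc
  have : isum P - isum N = 2 * (c - isum N) := by push_cast at hc; linarith
  rw [this]
  exact mul_dvd_mul_left 2 hd

/-- Half of the additional reflections get a minus sign, which merely translates the full set of
residues. -/
theorem reach_mono {m : ℕ} {F T : Multiset Term} (hFT : F ≤ T) (hF : Even (refl F))
    (hT : Even (refl T)) (h : reach m F = Set.univ) : reach m T = Set.univ := by
  obtain ⟨D, rfl⟩ := Multiset.le_iff_exists_add.1 hFT
  rw [refl_add, Nat.even_add] at hT
  obtain ⟨k, hk⟩ := hT.1 hF
  obtain ⟨M, hM, hMk⟩ := exists_le_refl_eq D k (by omega)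
  refine Set.eq_univ_of_forall fun x => ?_
  obtain ⟨N, hN, hNr, hNs⟩ : x - (isum M : ZMod m) ∈ reach m F := h ▸ Set.mem_univ _
  exact ⟨N + M, add_le_add hN hM, by simp; omega, by simp [hNs]⟩

theorem card_filter_add_refl (S : Multiset Term) :
    Multiset.card (S.filter fun e => e.2.2 = 0) + refl S = Multiset.card S := by
  induction S using Multiset.induction with
  | empty => simp
  | cons e S ih =>
    rcases zmod_two_cases e.2.2 with h | h
    · simp [h]; omega
    · have : (1 : ZMod 2).val = 1 := rfl
      simp [h, this]; omega

/-- Sequences with at most one reflection. -/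
theorem exists_balanced_of_refl_le_one (m : ℕ) (hm : 0 < m) (S : Multiset Term)
    (hS : 10 * m + 1 ≤ Multiset.card S) (hr : refl S ≤ 1) :
    ∃ T ≤ S, Multiset.card T = 8 * m ∧ Balanced m T := by
  classical
  have : NeZero m := ⟨hm.ne'⟩
  have hcard := card_filter_add_refl S
  have hexp : ∀ a : ZMod (2 * m) × ZMod 2, (8 * m) • a = 0 := by
    rintro ⟨a, b⟩
    have h1 : ((8 * m : ℕ) : ZMod (2 * m)) = 0 := by
      rw [ZMod.natCast_eq_zero_iff]; exact ⟨4, by ring⟩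
    have h2 : ((8 * m : ℕ) : ZMod 2) = 0 := by
      rw [ZMod.natCast_eq_zero_iff]; exact ⟨4 * m, by ring⟩
    rw [Prod.smul_mk, nsmul_eq_mul, nsmul_eq_mul, h1, h2, zero_mul, zero_mul]
    rfl
  -- At least `10m = 8m + 2m` rotations are present: the target length plus `D = 2m`.
  obtain ⟨T', hT', hTc, hTs⟩ := exists_zero_sum_of_card_eq (8 * m) (2 * m)
    (fun T hT => exists_zero_sum_zmod_prod m hm T hT)
    (by simp [ZMod.card]; omega) hexp
    ((S.filter fun e => e.2.2 = 0).map fun e => ((e.1 : ZMod (2 * m)), e.2.1))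
    (by rw [Multiset.card_map]; omega)
  obtain ⟨T, hT, rfl⟩ := exists_le_map_eq hT'
  rw [Multiset.card_map] at hTc
  have hsum : (T.map fun e => ((e.1 : ZMod (2 * m)), e.2.1)).sum =
      ((isum T : ZMod (2 * m)), jsum T) := by
    clear hTs hTc hT' hT
    induction T using Multiset.induction with
    | empty => simp; rfl
    | cons e T ih => simp [ih]
  rw [hsum, Prod.mk_eq_zero, ZMod.intCast_zmod_eq_zero_iff_dvd] at hTs
  refine ⟨T, hT.trans (Multiset.filter_le _ _), hTc, T, 0, by simp, ?_, by simp, ?_, hTs.2⟩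
  · rw [refl_zero]
    by_contra hne
    obtain ⟨e, he, h1⟩ := exists_mem_of_refl_pos (Nat.pos_of_ne_zero hne)
    have := (Multiset.mem_filter.1 (Multiset.mem_of_le hT he)).2
    simp [h1] at this
  · simpa using hTs.1

/-- The value of a pair of terms of the same class. -/
def pairValue (p : Term × Term) : ℤ :=
  if p.1.2.2 = 0 then (p.1.1 + p.2.1) / 2 else (p.1.1 - p.2.1) / 2

/-- Two rotations both get a plus sign, two reflections opposite signs. Equal classes make the
contribution of a pair even, and `pairValue` is half of it. -/
theorem balanced_of_pairs {m : ℕ} (Q : Multiset (Term × Term)) (hQ : ∀ p ∈ Q, cl p.1 = cl p.2)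
    (hs : (m : ℤ) ∣ (Q.map pairValue).sum) :
    Balanced m (Q.map Prod.fst + Q.map Prod.snd) := by
  suffices ∃ P N, Q.map Prod.fst + Q.map Prod.snd = P + N ∧ refl P = refl N ∧
      (refl P = 0 → N = 0) ∧ isum P - isum N = 2 * (Q.map pairValue).sum ∧
      jsum (Q.map Prod.fst + Q.map Prod.snd) = 0 by
    obtain ⟨P, N, h1, h2, h3, h4, h5⟩ := this
    exact ⟨P, N, h1, h2, h3, by rw [h4]; exact mul_dvd_mul_left 2 hs, h5⟩
  clear hs
  induction Q using Multiset.induction with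
  | empty => exact ⟨0, 0, by simp⟩
  | cons p Q ih =>
    obtain ⟨P, N, h1, h2, h3, h4, h5⟩ := ih fun q hq => hQ q (by simp [hq])
    obtain ⟨⟨a, j, ε⟩, ⟨b, j', ε'⟩⟩ := p
    have hp := hQ _ (Multiset.mem_cons_self _ _)
    simp only [cl, Prod.mk.injEq] at hp
    obtain ⟨hab, rfl, rfl⟩ := hp
    have hdvd : (2 : ℤ) ∣ b - a := (ZMod.intCast_eq_intCast_iff_dvd_sub _ _ 2).1 hab
    have hj : jsum ((((a, j, ε), (b, j, ε)) ::ₘ Q).map Prod.fst +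
        (((a, j, ε), (b, j, ε)) ::ₘ Q).map Prod.snd) = 0 := by
      have hjj : j + j = 0 := CharTwo.add_self_eq_zero j
      simp only [Multiset.map_cons, jsum_add, jsum_cons] at h5 ⊢
      linear_combination h5 + hjj
    rcases zmod_two_cases ε with rfl | rfl
    · refine ⟨(a, j, 0) ::ₘ (b, j, 0) ::ₘ P, N, ?_, by simpa using h2, by simpa using h3, ?_, hj⟩
      · rw [Multiset.map_cons, Multiset.map_cons, ← Multiset.singleton_add,
          ← Multiset.singleton_add (b, j, _), add_add_add_comm, h1]
        simp only [← Multiset.singleton_add]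
        abel
      · simp [pairValue]
        omega
    · have h11 : (1 : ZMod 2).val = 1 := rfl
      refine ⟨(a, j, 1) ::ₘ P, (b, j, 1) ::ₘ N, ?_, by simpa using h2, ?_, ?_, hj⟩
      · rw [Multiset.map_cons, Multiset.map_cons, ← Multiset.singleton_add,
          ← Multiset.singleton_add (b, j, _), add_add_add_comm, h1]
        simp only [← Multiset.singleton_add]
        abel
      · simp [h11]
      · simp [pairValue]
        omega

/-! ### Growth and periods of the set of reachable sums -/

theorem ncard_lt_ncard_union {α : Type*} [Finite α] {A B : Set α} (h : A.ncard = B.ncard)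
    (hne : A ≠ B) : A.ncard < (A ∪ B).ncard := by
  refine Set.ncard_lt_ncard ?_ (Set.toFinite _)
  refine ⟨Set.subset_union_left, fun hsub => hne ?_⟩
  exact (Set.eq_of_subset_of_ncard_le (Set.subset_union_right.trans hsub) h.le
    (Set.toFinite _)).symm

theorem zero_mem_reach_zero (m : ℕ) : (0 : ZMod m) ∈ reach m 0 := ⟨0, by simp⟩

theorem reach_cons_of_rotation {m : ℕ} (a : Term) (ha : a.2.2 = 0) (F : Multiset Term) :
    reach m F ∪ ((a.1 : ZMod m) +ᵥ reach m F) ⊆ reach m (a ::ₘ F) := by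
  rintro x (⟨N, hN, hr, hs⟩ | ⟨y, ⟨N, hN, hr, rfl⟩, rfl⟩)
  · exact ⟨N, hN.trans (Multiset.le_cons_self _ _), by simp [ha, hr], hs⟩
  · exact ⟨a ::ₘ N, (Multiset.cons_le_cons_iff _).2 hN, by simp [ha, hr], by simp⟩

theorem reach_cons_of_reflections {m : ℕ} (x y : Term) (hx : x.2.2 = 1) (hy : y.2.2 = 1)
    (F : Multiset Term) : ((x.1 : ZMod m) +ᵥ reach m F) ∪ ((y.1 : ZMod m) +ᵥ reach m F) ⊆
      reach m (x ::ₘ y ::ₘ F) := by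
  have h1 : (1 : ZMod 2).val = 1 := rfl
  rintro z (⟨_, ⟨N, hN, hr, rfl⟩, rfl⟩ | ⟨_, ⟨N, hN, hr, rfl⟩, rfl⟩)
  · exact ⟨x ::ₘ N, (Multiset.cons_le_cons_iff _).2 (hN.trans (Multiset.le_cons_self _ _)),
      by simp [hx, hy, h1]; omega, by simp⟩
  · exact ⟨y ::ₘ N, ((Multiset.cons_le_cons_iff _).2 hN).trans (Multiset.le_cons_self _ _),
      by simp [hx, hy, h1]; omega, by simp⟩

/-- The period of a proper non-empty subset of `ZMod m`. -/
theorem exists_period (m : ℕ) [NeZero m] (R : Set (ZMod m)) (hR : R.Nonempty)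
    (hR' : R ≠ Set.univ) : ∃ d k : ℕ, 1 < d ∧ d * k = m ∧ R.ncard + k ≤ m ∧
      ∀ i : ℤ, (i : ZMod m) +ᵥ R = R → (d : ℤ) ∣ i := by
  set K := AddAction.stabilizer (ZMod m) R with hK
  have hmul := K.card_mul_index
  rw [Nat.card_zmod] at hmul
  have hsurj : Function.Surjective (Int.castAddHom (ZMod m)) := ZMod.intCast_surjective
  obtain ⟨g, hg⟩ := Int.subgroup_cyclic (K.comap (Int.castAddHom (ZMod m)))
  have hgL : K.comap (Int.castAddHom (ZMod m)) = AddSubgroup.zmultiples g := by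
    rw [hg, AddSubgroup.zmultiples_eq_closure]
  have hind : K.index = g.natAbs := by
    rw [← AddSubgroup.index_comap_of_surjective K hsurj, hgL, Int.index_zmultiples]
  refine ⟨K.index, Nat.card K, ?_, by rw [mul_comm, hmul], ?_, ?_⟩
  · have h0 : K.index ≠ 0 := fun h => NeZero.ne m (by rw [← hmul, h, mul_zero])
    have h1 : K.index ≠ 1 := fun h => by
      rw [AddSubgroup.index_eq_one] at h
      obtain ⟨x, hx⟩ := hR
      refine hR' (Set.eq_univ_of_forall fun y => ?_)
      have : y - x ∈ K := h ▸ AddSubgroup.mem_top _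
      rw [hK, AddAction.mem_stabilizer_iff] at this
      rw [← this]
      exact ⟨x, hx, by simp⟩
    omega
  · obtain ⟨z, hz⟩ := (Set.ne_univ_iff_exists_notMem R).1 hR'
    -- The coset of the stabilizer through a point outside `R` misses `R`.
    have hle : (K : Set (ZMod m)).ncard ≤ Rᶜ.ncard := by
      refine Set.ncard_le_ncard_of_injOn (· + z) ?_ ((add_left_injective z).injOn) (Set.toFinite _)
      intro k hk hkz
      have : k +ᵥ R = R := hk
      rw [← this] at hkz
      obtain ⟨w, hw, hwz⟩ := hkz
      have hwz' : w = z := by simpa using hwz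
      exact hz (hwz' ▸ hw)
    have h1 := Set.ncard_add_ncard_compl R
    rw [Nat.card_zmod] at h1
    have h2 : Nat.card K = (K : Set (ZMod m)).ncard := rfl
    omega
  · intro i hi
    have hi' : i ∈ K.comap (Int.castAddHom (ZMod m)) := hi
    rw [hgL, Int.mem_zmultiples_iff] at hi'
    rw [hind]
    simpa using hi'

/-- Either few terms reach every residue, or all other terms are congruent. -/
theorem exists_reach_eq_univ_or (m c : ℕ) [NeZero m] (S F₀ : Multiset Term) (hF₀ : F₀ ≤ S)
    (hev : Even (refl F₀)) (hcard : Multiset.card F₀ + c + 2 ≤ 2 * (reach m F₀).ncard) :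
    ∃ F ≤ S, Even (refl F) ∧
      ((reach m F = Set.univ ∧ Multiset.card F + c + 2 ≤ 2 * m) ∨
      ∃ d k : ℕ, 1 < d ∧ d * k = m ∧ Multiset.card F + c + 2 + 2 * k ≤ 2 * m ∧
        (∀ e ∈ S - F, e.2.2 = 0 → (d : ℤ) ∣ e.1) ∧
        ∀ e ∈ S - F, ∀ e' ∈ S - F, e.2.2 = 1 → e'.2.2 = 1 → (d : ℤ) ∣ e.1 - e'.1) := by
  classical
  -- The condition on `F` survives adding at most two terms that produce a new sum. At a maximal
  -- `F`, no rotation and no pair of reflections outside `F` does so; their exponents, respectively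
  -- differences, therefore stabilize `reach m F`.
  obtain ⟨F, hF, hmax⟩ := Finset.exists_max_image
    (S.powerset.toFinset.filter fun F => Even (refl F) ∧
      Multiset.card F + c + 2 ≤ 2 * (reach m F).ncard) (fun F => (reach m F).ncard)
    ⟨F₀, by simp [hF₀, hev, hcard]⟩
  simp only [Finset.mem_filter, Multiset.mem_toFinset, Multiset.mem_powerset] at hF hmax
  obtain ⟨hFS, hFev, hFc⟩ := hF
  refine ⟨F, hFS, hFev, ?_⟩
  by_cases hR : reach m F = Set.univ
  · left
    rw [hR, Set.ncard_univ, Nat.card_zmod] at hFc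
    exact ⟨hR, hFc⟩
  right
  obtain ⟨d, k, hd, hdk, hk, hper⟩ := exists_period m (reach m F)
    (Set.nonempty_of_ncard_ne_zero (by omega)) hR
  have hncard : ∀ x : ZMod m, (x +ᵥ reach m F).ncard = (reach m F).ncard := fun x =>
    Set.ncard_image_of_injective _ (AddAction.injective x)
  refine ⟨d, k, hd, hdk, by omega, ?_, ?_⟩
  · intro a ha ha0
    refine hper a.1 (by_contra fun hne => ?_)
    have h1 := ncard_lt_ncard_union (hncard (a.1 : ZMod m)).symm (Ne.symm hne)
    have h2 := Set.ncard_le_ncard (reach_cons_of_rotation (m := m) a ha0 F) (Set.toFinite _)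
    have := hmax (a ::ₘ F) ⟨?_, by simpa [ha0] using hFev, by simp; omega⟩
    · omega
    · have := add_le_add_left (Multiset.singleton_le.2 ha) F
      rwa [Multiset.sub_add_cancel hFS] at this
  · intro x hx y hy hx1 hy1
    by_cases hxy : x = y
    · simp [hxy]
    refine hper (x.1 - y.1) (by_contra fun hne => ?_)
    have hne' : (x.1 : ZMod m) +ᵥ reach m F ≠ (y.1 : ZMod m) +ᵥ reach m F := by
      intro h
      apply hne
      rw [Int.cast_sub, sub_eq_neg_add, add_vadd, h, neg_vadd_vadd]
    have h1 := ncard_lt_ncard_union ((hncard (x.1 : ZMod m)).trans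
      (hncard (y.1 : ZMod m)).symm) hne'
    rw [hncard] at h1
    have h2 := Set.ncard_le_ncard (reach_cons_of_reflections (m := m) x y hx1 hy1 F)
      (Set.toFinite _)
    have h11 : (1 : ZMod 2).val = 1 := rfl
    have := hmax (x ::ₘ y ::ₘ F) ⟨?_, ?_, by simp; omega⟩
    · omega
    · have hle : x ::ₘ y ::ₘ 0 ≤ S - F := by
        refine (Multiset.le_iff_subset ?_).2 ?_
        · simp [hxy]
        · intro z hz
          simp only [Multiset.mem_cons, Multiset.notMem_zero, or_false] at hz
          rcases hz with rfl | rfl <;> assumption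
      have := add_le_add_left hle F
      rwa [Multiset.sub_add_cancel hFS, Multiset.cons_add, Multiset.cons_add, zero_add] at this
    · simp only [refl_cons, hx1, hy1, h11]
      rw [← add_assoc]
      exact (even_two).add hFev

/-- If few terms reach every residue, then a balanced sequence is obtained by omitting `R₀` and
some pairs of terms of the same class. -/
theorem exists_balanced_of_reach (m : ℕ) (S R₀ F : Multiset Term) (hR₀ : R₀ ≤ S)
    (hF : F ≤ S - R₀) (hev : Even (refl F)) (hreach : reach m F = Set.univ)
    (hFc : Multiset.card F + 2 ≤ 2 * m) (hcl : (R₀.map cl).sum = (S.map cl).sum)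
    (hS : Multiset.card S = 10 * m + 1)
    (hR₀c : Multiset.card R₀ = 1 ∨ Multiset.card R₀ = 3) (hr : 0 < refl (S - R₀)) :
    ∃ T ≤ S, Multiset.card T = 8 * m ∧ Balanced m T := by
  classical
  -- Minus signs need a reflection, so one is secured at the cost of at most one term.
  obtain ⟨F₁, hFF₁, hF₁, hF₁c, hF₁r⟩ : ∃ F₁, F ≤ F₁ ∧ F₁ ≤ S - R₀ ∧
      Multiset.card F₁ + 1 ≤ 2 * m ∧ 0 < refl F₁ := by
    by_cases h : 0 < refl F
    · exact ⟨F, le_rfl, hF, by omega, h⟩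
    · obtain ⟨D, hD⟩ := Multiset.le_iff_exists_add.1 hF
      rw [hD, refl_add] at hr
      obtain ⟨e, he, he1⟩ := exists_mem_of_refl_pos (S := D) (by omega)
      refine ⟨e ::ₘ F, Multiset.le_cons_self _ _, ?_, by simp; omega,
        refl_pos_of_mem (Multiset.mem_cons_self _ _) he1⟩
      rw [hD, ← Multiset.singleton_add, add_comm F]
      gcongr
      exact Multiset.singleton_le.2 he
  obtain ⟨W, hW⟩ := Multiset.le_iff_exists_add.1 hF₁
  obtain ⟨Q, O, rfl, hQ, hO⟩ := exists_pairing cl W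
  have hO8 : Multiset.card O ≤ 8 := by
    rw [← Multiset.card_map cl, ← Multiset.toFinset_card_of_nodup hO]
    exact Finset.card_le_univ _
  have hSeq : S = R₀ + (F₁ + (Q.map Prod.fst + Q.map Prod.snd + O)) := by
    rw [← hW, add_comm, Multiset.sub_add_cancel hR₀]
  have hcard := congrArg Multiset.card hSeq
  simp only [Multiset.card_add, Multiset.card_map, hS] at hcard
  -- Exactly `2m + 1` terms are to be omitted. Pairs have class sum zero, so omitting them keeps the
  -- class sum of the rest.
  obtain ⟨Q₁, hQ₁, hQ₁c⟩ : ∃ Q₁ ≤ Q, 2 * Multiset.card Q₁ + Multiset.card R₀ = 2 * m + 1 := by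
    rcases hR₀c with h | h
    · obtain ⟨Q₁, h1, h2⟩ := exists_le_card_eq (S := Q) (k := m) (by omega)
      exact ⟨Q₁, h1, by omega⟩
    · obtain ⟨Q₁, h1, h2⟩ := exists_le_card_eq (S := Q) (k := m - 1) (by omega)
      exact ⟨Q₁, h1, by omega⟩
  obtain ⟨Q₂, rfl⟩ := Multiset.le_iff_exists_add.1 hQ₁
  have hpair : (Q₁.map (cl ∘ Prod.fst)).sum + (Q₁.map (cl ∘ Prod.snd)).sum = 0 := by
    rw [Multiset.map_congr (f := cl ∘ Prod.fst) (g := cl ∘ Prod.snd) rfl fun p hp =>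
      hQ p (Multiset.mem_add.2 (Or.inl hp))]
    have : ∀ x : ZMod 2 × ZMod 2 × ZMod 2, x + x = 0 := by decide
    exact this _
  set T := F₁ + (Q₂.map Prod.fst + Q₂.map Prod.snd + O) with hT
  have hST : S = T + (R₀ + (Q₁.map Prod.fst + Q₁.map Prod.snd)) := by
    rw [hSeq, hT, Multiset.map_add, Multiset.map_add]
    abel
  have hTcl : (T.map cl).sum = 0 := by
    rw [hST] at hcl
    simp only [Multiset.map_add, Multiset.sum_add, Multiset.map_map, hpair, add_zero] at hcl
    simpa using hcl
  have hTev : Even (refl T) := by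
    have h := hTcl
    rw [sum_map_cl, Prod.mk_eq_zero, Prod.mk_eq_zero, ZMod.natCast_eq_zero_iff] at h
    exact even_iff_two_dvd.2 h.2.2
  have hFT : F₁ ≤ T := Multiset.le_add_right _ _
  refine ⟨T, hST ▸ Multiset.le_add_right _ _, ?_, balanced_of_reach hTcl ?_
    (reach_mono (hFF₁.trans hFT) hev hTev hreach)⟩
  · have := congrArg Multiset.card hST
    simp only [Multiset.card_add, Multiset.card_map, hS] at this
    omega
  · exact hF₁r.trans_le (refl_mono hFT)

/-! ### Descent to a proper divisor of `m` -/

/-- Restoring a common modulus `d` and a common residue `i₀` of the reflections. -/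
def expand (d i₀ : ℤ) (e : Term) : Term := (d * e.1 + i₀ * e.2.2.val, e.2)

theorem Balanced.map_expand {k d : ℕ} (i₀ : ℤ) {T : Multiset Term} (h : Balanced k T) :
    Balanced (d * k) (T.map (expand d i₀)) := by
  obtain ⟨P, N, rfl, h1, h2, h3, h4⟩ := h
  have hr : ∀ U : Multiset Term, refl (U.map (expand d i₀)) = refl U := fun U => by
    simp only [refl, Multiset.map_map]; rfl
  have hj : ∀ U : Multiset Term, jsum (U.map (expand d i₀)) = jsum U := fun U => by
    simp only [jsum, Multiset.map_map]; rfl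
  have hi : ∀ U : Multiset Term, isum (U.map (expand d i₀)) = d * isum U + i₀ * refl U := by
    intro U
    induction U using Multiset.induction with
    | empty => simp
    | cons e U ih =>
      simp only [Multiset.map_cons, isum_cons, ih, expand, refl_cons]
      push_cast
      ring
  refine ⟨P.map (expand d i₀), N.map (expand d i₀), Multiset.map_add _ _ _, by rw [hr, hr, h1],
    fun h => ?_, ?_, by rw [hj, h4]⟩
  · rw [hr] at h
    rw [h2 h, Multiset.map_zero]
  · rw [hi, hi, h1]
    obtain ⟨c, hc⟩ := h3
    refine ⟨c, ?_⟩
    push_cast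
    linear_combination (d : ℤ) * hc

/-- After removing `i₀` from the reflections and dividing by `d`, balanced pieces of length `8k` are
split off `d` times. Before each extraction at least `10k + 1` terms are left. -/
theorem exists_balanced_of_congruent {k d : ℕ}
    (hP : ∀ S : Multiset Term, 10 * k + 1 ≤ Multiset.card S →
      ∃ T ≤ S, Multiset.card T = 8 * k ∧ Balanced k T)
    (W : Multiset Term) (hW : 8 * (d * k) + 2 * k + 1 ≤ Multiset.card W)
    (h0 : ∀ e ∈ W, e.2.2 = 0 → (d : ℤ) ∣ e.1)
    (h1 : ∀ e ∈ W, ∀ e' ∈ W, e.2.2 = 1 → e'.2.2 = 1 → (d : ℤ) ∣ e.1 - e'.1) :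
    ∃ T ≤ W, Multiset.card T = 8 * (d * k) ∧ Balanced (d * k) T := by
  classical
  have hiter : ∀ q : ℕ, ∀ S : Multiset Term, 8 * (q * k) + 2 * k + 1 ≤ Multiset.card S →
      ∃ T ≤ S, Multiset.card T = 8 * (q * k) ∧ Balanced k T := by
    intro q
    induction q with
    | zero => exact fun S _ => ⟨0, by simp, by simp, Balanced.zero k⟩
    | succ q ih =>
      intro S hS
      have hq : (q + 1) * k = q * k + k := by ring
      rw [hq] at hS ⊢
      obtain ⟨T, hT, hTc, hTb⟩ := hP S (by omega)
      have := Multiset.card_sub hT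
      have := Multiset.card_le_card hT
      obtain ⟨T', hT', hTc', hTb'⟩ := ih (S - T) (by omega)
      refine ⟨T' + T, ?_, by simp; omega, hTb'.add hTb⟩
      have := add_le_add_left hT' T
      rwa [Multiset.sub_add_cancel hT] at this
  obtain ⟨i₀, hi₀⟩ : ∃ i₀ : ℤ, ∀ e ∈ W, e.2.2 = 1 → (d : ℤ) ∣ e.1 - i₀ := by
    by_cases h : ∃ e ∈ W, e.2.2 = 1
    · obtain ⟨e₀, he₀, he₀1⟩ := h
      exact ⟨e₀.1, fun e he he1 => h1 e he e₀ he₀ he1 he₀1⟩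
    · exact ⟨0, fun e he he1 => absurd ⟨e, he, he1⟩ h⟩
  have hWeq : (W.map fun e => ((e.1 - i₀ * e.2.2.val) / d, e.2)).map (expand d i₀) = W := by
    rw [Multiset.map_map]
    conv_rhs => rw [← Multiset.map_id W]
    refine Multiset.map_congr rfl fun e he => ?_
    have hdvd : (d : ℤ) ∣ e.1 - i₀ * e.2.2.val := by
      rcases zmod_two_cases e.2.2 with h | h
      · simpa [h] using h0 e he h
      · have h11 : (1 : ZMod 2).val = 1 := rfl
        simpa [h, h11] using hi₀ e he h
    simp only [Function.comp, expand, id]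
    rw [Int.mul_ediv_cancel' hdvd, sub_add_cancel]
  obtain ⟨T, hT, hTc, hTb⟩ := hiter d (W.map fun e => ((e.1 - i₀ * e.2.2.val) / d, e.2))
    (by rwa [Multiset.card_map])
  refine ⟨T.map (expand d i₀), ?_, by rw [Multiset.card_map, hTc], hTb.map_expand i₀⟩
  rw [← hWeq]
  exact Multiset.map_le_map hT

/-! ### The upper bound in the integer model -/

/-- Only four of the eight classes belong to rotations. -/
theorem three_le_refl_of_card_seven (O : Multiset Term) (hO : (O.map cl).Nodup)
    (hO7 : Multiset.card O = 7) : 3 ≤ refl O := by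
  classical
  have hcard := card_filter_add_refl O
  have hnd : ((O.filter fun e => e.2.2 = 0).map cl).Nodup :=
    Multiset.nodup_of_le (Multiset.map_le_map (Multiset.filter_le _ _)) hO
  have hsub : ((O.filter fun e => e.2.2 = 0).map cl).toFinset ⊆
      Finset.univ.filter fun x => x.2.2 = 0 := by
    intro x hx
    obtain ⟨e, he, rfl⟩ := Multiset.mem_map.1 (Multiset.mem_toFinset.1 hx)
    simpa [cl] using (Multiset.mem_filter.1 he).2
  have hle := Finset.card_le_card hsub
  have h4 : (Finset.univ.filter fun x : ZMod 2 × ZMod 2 × ZMod 2 => x.2.2 = 0).card = 4 := by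
    decide
  rw [Multiset.toFinset_card_of_nodup hnd, Multiset.card_map] at hle
  omega

theorem exists_balanced (m : ℕ) (hm : 0 < m) (S : Multiset Term)
    (hS : 10 * m + 1 ≤ Multiset.card S) :
    ∃ T ≤ S, Multiset.card T = 8 * m ∧ Balanced m T := by
  classical
  induction m using Nat.strong_induction_on generalizing S with
  | _ m ih =>
  have : NeZero m := ⟨hm.ne'⟩
  obtain ⟨S', hS', hSc⟩ := exists_le_card_eq hS
  suffices ∃ T ≤ S', Multiset.card T = 8 * m ∧ Balanced m T by
    obtain ⟨T, hT, h⟩ := this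
    exact ⟨T, hT.trans hS', h⟩
  clear hS' hS S
  rename' S' => S
  by_cases hr : refl S ≤ 1
  · exact exists_balanced_of_refl_le_one m hm S hSc.ge hr
  have hcong : ∀ d k : ℕ, 1 < d → d * k = m → ∀ W ≤ S, 8 * m + 2 * k + 1 ≤ Multiset.card W →
      (∀ e ∈ W, e.2.2 = 0 → (d : ℤ) ∣ e.1) →
      (∀ e ∈ W, ∀ e' ∈ W, e.2.2 = 1 → e'.2.2 = 1 → (d : ℤ) ∣ e.1 - e'.1) →
      ∃ T ≤ S, Multiset.card T = 8 * m ∧ Balanced m T := by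
    rintro d k hd rfl W hWS hW h0 h1
    have hk : 0 < k := Nat.pos_of_mul_pos_left hm
    obtain ⟨T, hT, h⟩ := exists_balanced_of_congruent
      (ih k (lt_mul_of_one_lt_left hk hd) hk) W hW h0 h1
    exact ⟨T, hT.trans hWS, h⟩
  obtain ⟨Q, O, hSQ, hQ, hO⟩ := exists_pairing cl S
  have hcard := congrArg Multiset.card hSQ
  simp only [Multiset.card_add, Multiset.card_map, hSc] at hcard
  have hOc : (O.map cl).toFinset.card = Multiset.card O := by
    rw [Multiset.toFinset_card_of_nodup hO, Multiset.card_map]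
  have hO8 : Multiset.card O ≤ 8 := by
    rw [← hOc]
    exact Finset.card_le_univ _
  by_cases hO3 : Multiset.card O ≤ 3
  -- There are at least `5m - 1` pairs, just enough to extract `m` of them four times.
  · obtain ⟨Q', hQ', hQ'c, hQ's⟩ := exists_dvd_sum_of_card_le m 4 hm pairValue Q (by omega)
    refine ⟨Q'.map Prod.fst + Q'.map Prod.snd, ?_, by simp; omega,
      balanced_of_pairs Q' (fun p hp => hQ p (Multiset.mem_of_le hQ' hp)) hQ's⟩
    rw [hSQ]
    exact (add_le_add (Multiset.map_le_map hQ') (Multiset.map_le_map hQ')).trans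
      (Multiset.le_add_right _ _)
  have hOS : O ≤ S := hSQ ▸ Multiset.le_add_left _ _
  have hOsum : ∑ x ∈ (O.map cl).toFinset, x = (S.map cl).sum := by
    have h1 : ∑ x ∈ (O.map cl).toFinset, x = (O.map cl).sum := by
      refine (Finset.sum_val _).symm.trans ?_
      rw [Multiset.toFinset_val, hO.dedup]
    rw [h1, hSQ, Multiset.map_add, Multiset.map_add, Multiset.map_map, Multiset.map_map,
      Multiset.map_congr rfl (f := cl ∘ Prod.fst) (g := cl ∘ Prod.snd) hQ]
    have : ∀ x y : ZMod 2 × ZMod 2 × ZMod 2, y = x + x + y := by decide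
    simp only [Multiset.sum_add]
    exact this _ _
  -- Pairing preserves parity, and `10m + 1` is odd.
  have hO57 : Multiset.card O = 5 ∨ Multiset.card O = 7 := by omega
  rcases hO57 with hO5 | hO7
  · obtain ⟨z, hz, hzs⟩ := Multiset.mem_map.1
      (Multiset.mem_toFinset.1 (sum_mem_of_card_five _ (hOc.trans hO5)))
    rw [hOsum] at hzs
    have hzS : {z} ≤ S := Multiset.singleton_le.2 (Multiset.mem_of_le hOS hz)
    have hrz : 0 < refl (S - {z}) := by
      have h1 := congrArg refl (Multiset.sub_add_cancel hzS)
      have h2 := refl_le_card {z}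
      rw [refl_add] at h1
      rw [Multiset.card_singleton] at h2
      omega
    obtain ⟨F, hF, hev, ⟨hFr, hFc⟩ | ⟨d, k, hd, hdk, hFc, h0, h1⟩⟩ :=
      exists_reach_eq_univ_or m 0 (S - {z}) 0 (by simp) (by simp) (by
        have := (Set.ncard_pos (Set.toFinite _)).2 ⟨_, zero_mem_reach_zero m⟩
        simp
        omega)
    · exact exists_balanced_of_reach m S {z} F hzS hF hev hFr (by omega) (by simpa using hzs) hSc
        (by simp) hrz
    · refine hcong d k hd hdk (S - {z} - F)
        ((Multiset.sub_le_self _ _).trans (Multiset.sub_le_self _ _)) ?_ h0 h1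
      rw [Multiset.card_sub hF, Multiset.card_sub hzS, Multiset.card_singleton]
      omega
  · have htriple : ∀ c, ∃ R ≤ S, Multiset.card R = 3 ∧ (R.map cl).sum = (S.map cl).sum ∧
        (∀ e ∈ R, cl e ≠ c) ∧ (∃ e ∈ R, e.2.2 = 0) ∧ 0 < refl (S - R) := by
      intro c
      obtain ⟨U, hUO, hU3, hUs, hcU, x, hxU, hx0⟩ :=
        exists_triple_of_card_seven _ (hOc.trans hO7) c
      obtain ⟨R, hR, hRU⟩ := exists_le_of_subset_classes U hUO
      have hR3 : Multiset.card R = 3 := by rw [← Multiset.card_map cl, hRU]; exact hU3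
      have hxR : x ∈ R.map cl := by rw [hRU]; exact hxU
      obtain ⟨e, he, hex⟩ := Multiset.mem_map.1 hxR
      have he0 : e.2.2 = 0 := by rw [← hx0, ← hex]; rfl
      refine ⟨R, hR.trans hOS, hR3, ?_, ?_, ⟨e, he, he0⟩, ?_⟩
      · rw [hRU, Finset.sum_val, ← hOsum, ← hUs]
        rfl
      · rintro e he rfl
        exact hcU (by rw [← Finset.mem_val, ← hRU]; exact Multiset.mem_map_of_mem cl he)
      · have h1 := congrArg refl (Multiset.sub_add_cancel (hR.trans hOS))
        have h2 := three_le_refl_of_card_seven O hO hO7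
        have h3 := refl_mono hOS
        obtain ⟨R', rfl⟩ := Multiset.exists_cons_of_mem he
        have h4 := refl_le_card R'
        rw [refl_add, refl_cons, he0, ZMod.val_zero] at h1
        rw [Multiset.card_cons] at hR3
        omega
    -- In the congruent case `|F| ≤ 2m - 2k - c - 2`, so `8m + 2k + 1` terms survive outside `R` and
    -- `F` only if `|R| ≤ c + 2`. As `|R| = 3`, one term must be gained. A rotation not divisible by
    -- `m` gives it: alone it already reaches two residues, which allows `c = 1`.
    by_cases ha : ∃ a ∈ S, a.2.2 = 0 ∧ ¬ (m : ℤ) ∣ a.1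
    · obtain ⟨a, haS, ha0, ham⟩ := ha
      obtain ⟨R, hRS, hR3, hRs, hRa, -, hrR⟩ := htriple (cl a)
      have haR : a ∈ S - R := by
        rw [← Multiset.sub_add_cancel hRS, Multiset.mem_add] at haS
        exact haS.resolve_right fun h => hRa a h rfl
      obtain ⟨F, hF, hev, ⟨hFr, hFc⟩ | ⟨d, k, hd, hdk, hFc, h0, h1⟩⟩ :=
        exists_reach_eq_univ_or m 1 (S - R) (a ::ₘ 0) (by simpa using haR)
          (by rw [refl_cons, ha0]; decide) (by
          have hsub : {0, (a.1 : ZMod m)} ⊆ reach m (a ::ₘ 0) := by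
            refine Set.Subset.trans ?_ (reach_cons_of_rotation a ha0 0)
            rintro x (rfl | rfl)
            · exact Or.inl (zero_mem_reach_zero m)
            · exact Or.inr ⟨0, zero_mem_reach_zero m, by simp⟩
          have h2 := Set.ncard_le_ncard hsub (Set.toFinite _)
          rw [Set.ncard_pair fun h => ham ((ZMod.intCast_zmod_eq_zero_iff_dvd _ _).1 h.symm)] at h2
          rw [Multiset.card_cons, Multiset.card_zero]
          omega)
      · exact exists_balanced_of_reach m S R F hRS hF hev hFr (by omega) hRs hSc (by simp [hR3]) hrR
      · refine hcong d k hd hdk (S - R - F)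
          ((Multiset.sub_le_self _ _).trans (Multiset.sub_le_self _ _)) ?_ h0 h1
        rw [Multiset.card_sub hF, Multiset.card_sub hRS]
        omega
    -- Now every rotation is divisible by `m`, hence by `d`, so the rotation in `R` can be returned
    -- to the congruent terms; this makes up for `c = 0`.
    · push Not at ha
      obtain ⟨R, hRS, hR3, hRs, -, ⟨a, haR, ha0⟩, hrR⟩ := htriple 0
      obtain ⟨F, hF, hev, ⟨hFr, hFc⟩ | ⟨d, k, hd, hdk, hFc, h0, h1⟩⟩ :=
        exists_reach_eq_univ_or m 0 (S - R) 0 (by simp) (by simp) (by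
          have := (Set.ncard_pos (Set.toFinite _)).2 ⟨_, zero_mem_reach_zero m⟩
          simp
          omega)
      · exact exists_balanced_of_reach m S R F hRS hF hev hFr (by omega) hRs hSc (by simp [hR3]) hrR
      · refine hcong d k hd hdk (a ::ₘ (S - R - F)) ?_ ?_ ?_ ?_
        · rw [← Multiset.singleton_add]
          calc {a} + (S - R - F) ≤ R + (S - R) :=
                add_le_add (Multiset.singleton_le.2 haR) (Multiset.sub_le_self _ _)
            _ = S := by rw [add_comm, Multiset.sub_add_cancel hRS]
        · rw [Multiset.card_cons, Multiset.card_sub hF, Multiset.card_sub hRS]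
          omega
        · intro e he he0
          rcases Multiset.mem_cons.1 he with rfl | he
          · exact (Int.natCast_dvd_natCast.2 ⟨k, hdk.symm⟩).trans
              (ha _ (Multiset.mem_of_le hRS haR) ha0)
          · exact h0 e he he0
        · intro e he e' he' he1 he1'
          rcases Multiset.mem_cons.1 he with rfl | he
          · exact absurd (ha0.symm.trans he1) (by decide)
          rcases Multiset.mem_cons.1 he' with rfl | he'
          · exact absurd (ha0.symm.trans he1') (by decide)
          exact h1 e he e' he' he1 he1'

/-! ### The lower bounds -/

theorem mul_mem_products {G : Type*} [Group G] {S T : GroupSeq G} {g h : G} (hg : g ∈ products S)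
    (hh : h ∈ products T) : g * h ∈ products (S + T) := by
  obtain ⟨l, rfl, rfl⟩ := hg
  obtain ⟨l', rfl, rfl⟩ := hh
  exact ⟨l ++ l', by simp, by simp⟩

theorem mem_products_singleton {G : Type*} [Group G] (g : G) : g ∈ products ({g} : GroupSeq G) :=
  ⟨[g], by simp, by simp⟩

/-- Padding a product-one free sequence by ones. -/
theorem card_add_card_le_of_mem_gaoLengths {G : Type*} [Group G] [Finite G] {S : GroupSeq G}
    (hS : IsProductOneFree S) {l : ℕ} (hl : l ∈ gaoLengths G) :
    Multiset.card S + Nat.card G ≤ l := by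
  classical
  by_contra! hlt
  have hG : 0 < Nat.card G := Nat.card_pos
  obtain ⟨T, hT, hTc, L, rfl, hL⟩ := hl.2 (S + Multiset.replicate (Nat.card G - 1) 1)
    (by rw [Multiset.card_add, Multiset.card_replicate]; omega)
  have h1S : (1 : G) ∉ S := fun h =>
    hS ⟨{1}, Multiset.singleton_le.2 h, by simp, mem_products_singleton 1⟩
  have hprod : ∀ L : List G, (L.filter fun g => g ≠ 1).prod = L.prod := by
    intro L
    induction L with
    | nil => rfl
    | cons g L ih =>
      by_cases hg : g = 1
      · subst hg
        simpa using ih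
      · rw [List.filter_cons_of_pos (by simpa using hg), List.prod_cons, ih, List.prod_cons]
  have hle : ((L.filter fun g => g ≠ 1 : List G) : Multiset G) ≤ S := by
    have h := Multiset.filter_le_filter (fun g : G => g ≠ 1) hT
    have h1 : Multiset.filter (fun g : G => g ≠ 1) (Multiset.replicate (Nat.card G - 1) 1) = 0 :=
      Multiset.filter_eq_nil.2 fun g hg => by simpa using Multiset.eq_of_mem_replicate hg
    rw [Multiset.filter_add, h1, add_zero, Multiset.filter_coe] at h
    exact h.trans (Multiset.filter_le _ _)
  refine hS ⟨_, hle, ?_, _, rfl, (hprod L).trans hL⟩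
  -- `L` has `|G|` terms but at most `|G| - 1` ones are available, so deleting the ones leaves a
  -- non-empty sequence.
  by_contra! hcard
  have hall : ∀ g ∈ L, g = 1 := by
    have : (L.filter fun g => g ≠ 1) = [] := List.eq_nil_of_length_eq_zero (by
      rw [Multiset.coe_card] at hcard; omega)
    simpa [List.filter_eq_nil_iff] using this
  have hcount := Multiset.count_le_of_le 1 hT
  rw [Multiset.count_eq_card.2 (fun g hg => (hall g hg).symm), hTc, Multiset.count_add,
    Multiset.count_eq_zero_of_notMem h1S, Multiset.count_replicate_self] at hcount
  omega

/-- The homomorphism from the dihedral group onto the group of order two. -/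
def reflectionHom (n : ℕ) : DihedralGroup n →* Multiplicative (ZMod 2) where
  toFun
    | .r _ => 1
    | .sr _ => Multiplicative.ofAdd 1
  map_one' := rfl
  map_mul' := by
    rintro (i | i) (j | j) <;>
      simp only [DihedralGroup.r_mul_r, DihedralGroup.r_mul_sr, DihedralGroup.sr_mul_r,
        DihedralGroup.sr_mul_sr] <;> decide

/-- The image in a commutative group does not depend on the order, and `a` would be the only factor
with non-trivial image. -/
theorem not_mem_of_hom {G H : Type*} [Group G] [CommGroup H] (f : G →* H) {L : List G} {a : G}
    {S : Multiset G} (hL : (L : Multiset G) ≤ a ::ₘ S) (hS : ∀ g ∈ S, f g = 1) (ha : f a ≠ 1)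
    (hprod : L.prod = 1) : a ∉ L := by
  intro haL
  obtain ⟨T, hT⟩ := Multiset.exists_cons_of_mem (Multiset.mem_coe.2 haL)
  rw [hT, Multiset.cons_le_cons_iff] at hL
  have h := map_list_prod f L
  rw [hprod, map_one, ← Multiset.prod_coe, ← Multiset.map_coe, hT, Multiset.map_cons,
    Multiset.prod_cons, Multiset.prod_eq_one (s := T.map f), mul_one] at h
  · exact ha h.symm
  · intro x hx
    obtain ⟨g, hg, rfl⟩ := Multiset.mem_map.1 hx
    exact hS g (Multiset.mem_of_le hL hg)

/-- The two homomorphisms to `C_2` exclude the reflection and the central generator in turn; fewer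
than `n` copies of a rotation of order `n` remain. -/
theorem exists_productOneFree (n : ℕ) (hn : 2 ≤ n) :
    ∃ S : GroupSeq (DihedralTimesC2 n), Multiset.card S = n + 1 ∧ IsProductOneFree S := by
  let a : DihedralTimesC2 n := (.r 1, 1)
  let b : DihedralTimesC2 n := (.sr 0, 1)
  let c : DihedralTimesC2 n := (1, Multiplicative.ofAdd 1)
  refine ⟨b ::ₘ c ::ₘ Multiset.replicate (n - 1) a, by simp; omega, ?_⟩
  rintro ⟨T, hT, hTc, L, rfl, hL⟩
  have h11 : Multiplicative.ofAdd (1 : ZMod 2) ≠ 1 := by decide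
  have hb : b ∉ L := by
    refine not_mem_of_hom ((reflectionHom n).comp (MonoidHom.fst _ _)) hT ?_ h11 hL
    intro g hg
    rcases Multiset.mem_cons.1 hg with rfl | hg
    · rfl
    · rw [Multiset.eq_of_mem_replicate hg]; rfl
  rw [Multiset.le_cons_of_notMem (by simpa using hb)] at hT
  have hc : c ∉ L := by
    refine not_mem_of_hom (MonoidHom.snd _ _) hT ?_ h11 hL
    intro g hg
    rw [Multiset.eq_of_mem_replicate hg]
    rfl
  rw [Multiset.le_cons_of_notMem (by simpa using hc)] at hT
  have hrep : L = List.replicate L.length a := List.eq_replicate_iff.2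
    ⟨rfl, fun g hg => Multiset.eq_of_mem_replicate (Multiset.mem_of_le hT hg)⟩
  have hlen := Multiset.card_le_card hT
  rw [Multiset.card_replicate, Multiset.coe_card] at hlen
  rw [Multiset.coe_card] at hTc
  rw [hrep, List.prod_replicate, Prod.ext_iff, Prod.pow_fst, DihedralGroup.r_one_pow,
    Prod.fst_one, DihedralGroup.one_def, DihedralGroup.r.injEq, ZMod.natCast_eq_zero_iff] at hL
  have := Nat.le_of_dvd (by omega) hL.1
  omega

/-! ### From the integer model back to the group -/

/-- The group element described by a term. -/
def ofTerm (n : ℕ) (e : Term) : DihedralTimesC2 n :=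
  (if e.2.2 = 0 then .r e.1 else .sr e.1, Multiplicative.ofAdd e.2.1)

theorem ofTerm_of_reflection (n : ℕ) (e : Term) (he : e.2.2 = 1) :
    ofTerm n e = (.sr e.1, Multiplicative.ofAdd e.2.1) := by
  rw [ofTerm, if_neg (by rw [he]; exact one_ne_zero)]

/-- A term describing a group element. -/
def toTerm {n : ℕ} (g : DihedralTimesC2 n) : Term :=
  match g.1 with
  | .r i => (i.val, g.2.toAdd, 0)
  | .sr i => (i.val, g.2.toAdd, 1)

theorem ofTerm_toTerm {n : ℕ} [NeZero n] (g : DihedralTimesC2 n) : ofTerm n (toTerm g) = g := by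
  obtain ⟨i | i, j⟩ := g <;> simp [ofTerm, toTerm]

theorem mem_products_of_rotations (n : ℕ) (S : Multiset Term) (hS : ∀ e ∈ S, e.2.2 = 0) :
    ((.r (isum S : ZMod n), Multiplicative.ofAdd (jsum S)) : DihedralTimesC2 n) ∈
      products (S.map (ofTerm n)) := by
  induction S using Multiset.induction with
  | empty => exact ⟨[], by simp, by simp [Prod.ext_iff]⟩
  | cons e S ih =>
    have := mul_mem_products (mem_products_singleton (ofTerm n e)) (ih fun f hf => hS f (by simp [hf]))
    rw [Multiset.singleton_add] at this
    rw [Multiset.map_cons]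
    convert this using 1
    simp [ofTerm, hS e (by simp)]

theorem mem_products_of_reflections (n : ℕ) (X Y : Multiset Term) (hX : ∀ e ∈ X, e.2.2 = 1)
    (hY : ∀ e ∈ Y, e.2.2 = 1) (hXY : Multiset.card X = Multiset.card Y) :
    ((.r ((isum X - isum Y : ℤ) : ZMod n), Multiplicative.ofAdd (jsum (X + Y))) :
      DihedralTimesC2 n) ∈ products ((X + Y).map (ofTerm n)) := by
  induction X using Multiset.induction generalizing Y with
  | empty =>
    obtain rfl : Y = 0 := Multiset.card_eq_zero.1 (by simpa using hXY.symm)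
    exact ⟨[], by simp, by simp [Prod.ext_iff]⟩
  | cons x X ih =>
    obtain ⟨y, hy⟩ := Multiset.exists_mem_of_ne_zero (s := Y) (by rintro rfl; simp at hXY)
    obtain ⟨Y, rfl⟩ := Multiset.exists_cons_of_mem hy
    have := mul_mem_products (mul_mem_products (mem_products_singleton (ofTerm n y))
      (mem_products_singleton (ofTerm n x))) (ih Y (fun f hf => hX f (by simp [hf]))
        (fun f hf => hY f (by simp [hf])) (by simpa using hXY))
    convert this using 1
    · congr 1
      simp only [Multiset.map_cons, Multiset.map_add]
      simp only [← Multiset.singleton_add]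
      abel
    · simp only [ofTerm_of_reflection _ _ (hX x (by simp)),
        ofTerm_of_reflection _ _ (hY y (by simp)), Prod.mk_mul_mk,
        DihedralGroup.sr_mul_sr, DihedralGroup.r_mul_r, ← ofAdd_add, isum_cons, jsum_add, jsum_cons]
      push_cast
      congr 2 <;> ring

/-- The ordering is: the rotations of `P`, then a reflection of `N`, all rotations of `N` and a
reflection of `P`, then the other reflections in pairs. Rotations enclosed by two reflections are
inverted, which gives them their minus sign. -/
theorem Balanced.isProductOne {m : ℕ} {T : Multiset Term} (h : Balanced m T) :
    IsProductOne (T.map (ofTerm (2 * m))) := by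
  classical
  obtain ⟨P, N, rfl, hr, hN, hs, hj⟩ := h
  have hsplit : ∀ U : Multiset Term, ∃ A X : Multiset Term, U = A + X ∧ (∀ e ∈ A, e.2.2 = 0) ∧
      (∀ e ∈ X, e.2.2 = 1) ∧ Multiset.card X = refl U := by
    intro U
    have h1 := Multiset.filter_add_not (fun e : Term => e.2.2 = 0) U
    have h2 := card_filter_add_refl U
    have h3 := congrArg Multiset.card h1
    rw [Multiset.card_add] at h3
    exact ⟨_, _, h1.symm, fun e he => (Multiset.mem_filter.1 he).2,
      fun e he => (zmod_two_cases e.2.2).resolve_left (Multiset.mem_filter.1 he).2, by omega⟩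
  obtain ⟨A, X, hP, hA, hX, hXc⟩ := hsplit P
  obtain ⟨B, Y, hNeq, hB, hY, hYc⟩ := hsplit N
  have key : ((.r ((isum X - isum N : ℤ) : ZMod (2 * m)), Multiplicative.ofAdd (jsum (X + N))) :
      DihedralTimesC2 (2 * m)) ∈ products ((X + N).map (ofTerm (2 * m))) := by
    by_cases hX0 : X = 0
    · subst hX0
      rw [hN (by rw [← hXc, Multiset.card_zero])]
      exact mem_products_of_reflections (2 * m) 0 0 (by simp) (by simp) rfl
    · obtain ⟨x, hx⟩ := Multiset.exists_mem_of_ne_zero hX0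
      obtain ⟨X, rfl⟩ := Multiset.exists_cons_of_mem hx
      obtain ⟨y, hy⟩ := Multiset.exists_mem_of_ne_zero (s := Y) (by
        rintro rfl
        rw [Multiset.card_cons, hr] at hXc
        rw [Multiset.card_zero] at hYc
        omega)
      obtain ⟨Y, rfl⟩ := Multiset.exists_cons_of_mem hy
      have := mul_mem_products (mul_mem_products (mul_mem_products
        (mem_products_singleton (ofTerm (2 * m) y)) (mem_products_of_rotations (2 * m) B hB))
        (mem_products_singleton (ofTerm (2 * m) x)))
        (mem_products_of_reflections (2 * m) X Y (fun f hf => hX f (by simp [hf]))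
          (fun f hf => hY f (by simp [hf])) (by
            rw [Multiset.card_cons] at hXc hYc
            omega))
      convert this using 1
      · congr 1
        simp only [hNeq, Multiset.map_cons, Multiset.map_add]
        simp only [← Multiset.singleton_add]
        abel
      · simp only [ofTerm_of_reflection _ _ (hX x (by simp)),
          ofTerm_of_reflection _ _ (hY y (by simp)), Prod.mk_mul_mk,
          DihedralGroup.sr_mul_sr, DihedralGroup.sr_mul_r, DihedralGroup.r_mul_r, ← ofAdd_add,
          isum_cons, jsum_add, jsum_cons, hNeq, isum_add]
        push_cast
        congr 2 <;> ring
  have := mul_mem_products (mem_products_of_rotations (2 * m) A hA) key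
  have hsum : ((isum A : ℤ) : ZMod (2 * m)) + ((isum X - isum N : ℤ) : ZMod (2 * m)) = 0 := by
    rw [← Int.cast_add, ZMod.intCast_zmod_eq_zero_iff_dvd]
    rw [hP, isum_add] at hs
    push_cast
    convert hs using 1
    ring
  have hj' : jsum A + jsum (X + N) = 0 := by
    rw [← hj, hP]
    simp only [jsum_add]
    ring
  rw [Prod.mk_mul_mk, DihedralGroup.r_mul_r, hsum, ← ofAdd_add, hj', ← Multiset.map_add,
    ← add_assoc, ← hP] at this
  exact this

theorem card_dihedralTimesC2 (n : ℕ) : Nat.card (DihedralTimesC2 n) = 4 * n := by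
  rw [Nat.card_prod, DihedralGroup.nat_card, Nat.card_congr Multiplicative.toAdd, Nat.card_zmod]
  ring

theorem mem_gaoLengths (n : ℕ) (hn : 0 < n) (hne : Even n) :
    5 * n + 1 ∈ gaoLengths (DihedralTimesC2 n) := by
  have : NeZero n := ⟨hn.ne'⟩
  obtain ⟨m, hm⟩ := hne
  obtain rfl : n = 2 * m := by omega
  refine ⟨by omega, fun S hS => ?_⟩
  obtain ⟨T, hT, hTc, hTb⟩ := exists_balanced m (by omega) (S.map toTerm)
    (by rw [Multiset.card_map]; omega)
  refine ⟨T.map (ofTerm (2 * m)), ?_, ?_, hTb.isProductOne⟩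
  · have := Multiset.map_le_map (f := ofTerm (2 * m)) hT
    rw [Multiset.map_map] at this
    simpa [Function.comp_def, ofTerm_toTerm] using this
  · rw [Multiset.card_map, hTc, card_dihedralTimesC2]
    ring

end ZeroSum

theorem mainTheorem2 (n : ℕ) (hn : 4 ≤ n) (hne : Even n) :
    (IsLeast (ZeroSum.gaoLengths (DihedralTimesC2 n)) (5 * n + 1) ∧
      ZeroSum.gaoConstant (DihedralTimesC2 n) = 5 * n + 1) ∧
    (IsGreatest (ZeroSum.productOneFreeLengths (DihedralTimesC2 n)) (n + 1) ∧
      ZeroSum.smallDavenport (DihedralTimesC2 n) = n + 1) ∧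
    ZeroSum.gaoConstant (DihedralTimesC2 n) =
      ZeroSum.smallDavenport (DihedralTimesC2 n) + Nat.card (DihedralTimesC2 n) := by
  have : NeZero n := ⟨by omega⟩
  have hcard := ZeroSum.card_dihedralTimesC2 n
  have hmem := ZeroSum.mem_gaoLengths n (by omega) hne
  obtain ⟨S, hS, hfree⟩ := ZeroSum.exists_productOneFree n (by omega)
  have hE : IsLeast (ZeroSum.gaoLengths (DihedralTimesC2 n)) (5 * n + 1) := by
    refine ⟨hmem, fun l hl => ?_⟩
    have := ZeroSum.card_add_card_le_of_mem_gaoLengths hfree hl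
    omega
  -- The padding inequality, read with `E ≤ 5n + 1`, bounds product-one free lengths by `5n + 1 -
  -- 4n`.
  have hd : IsGreatest (ZeroSum.productOneFreeLengths (DihedralTimesC2 n)) (n + 1) := by
    refine ⟨⟨S, hS, hfree⟩, ?_⟩
    rintro k ⟨T, rfl, hT⟩
    have := ZeroSum.card_add_card_le_of_mem_gaoLengths hT hmem
    omega
  have hE' : ZeroSum.gaoConstant (DihedralTimesC2 n) = 5 * n + 1 := hE.csInf_eq
  have hd' : ZeroSum.smallDavenport (DihedralTimesC2 n) = n + 1 := hd.csSup_eq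
  exact ⟨⟨hE, hE'⟩, ⟨hd, hd'⟩, by rw [hE', hd', hcard]; ring⟩
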